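/- Let $\nu$ be a $\sigma$-finite measure on a measurable space $\mathscr Y$, let $\mu$ be a $\sigma$-finite Borel measure on a separable metrizable space $\mathscr U$, and let $\Theta$ be a finite set. For each $\theta\in\Theta$ let $(y,u)\mapsto p(y\mid\theta,u)\ge 0$ be a jointly measurable kernel such that $p(\cdot\mid\theta,u)$ is a probability density with respect to $\nu$ for every $u\in\mathscr U$. Let $\overline{\mathbb F}$ be the closure, in the topology of weak convergence of Borel probability measures on $\mathscr U$, of the set $\mathbb F$ of probability measures having a density with respect to $\mu$. For $F\in\overline{\mathbb F}$ put \[ m_{F,\theta}(y)=\int p(y\mid\theta,u)\,dF(u), \] and for probability densities $m,g$ with respect to $\nu$ let $K(m,g)=\int \log\{m(y)/g(y)\}\,m(y)\,d\nu(y)\in[0,\infty]$ be the Kullback--Leibler divergence. Write $K^\star(\theta)=\inf\{K(m,m_{F,\theta}) : F\in\overline{\mathbb F}\}$. For each $\theta$ let $f_{0,\theta}$ be a probability density with respect to $\mu$ of full support, that is, $\int_O f_{0,\theta}\,d\mu>0$ for every open $O\subseteq\mathscr U$ with $\mu(O)>0$, and let $w_1,w_2,\ldots\in(0,1)$. Given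 observations $Y_1,Y_2,\ldots$, define for $i\ge 1$ the predictive recursion \[ f_{i,\theta}(u)=(1-w_i)f_{i-1,\theta}(u)+w_i\,\frac{p(Y_i\mid\theta,u)f_{i-1,\theta}(u)}{\int p(Y_i\mid\theta,u')f_{i-1,\theta}(u')\,d\mu(u')}, \] and set $m_{i,\theta}(y)=\int p(y\mid\theta,u)f_{i,\theta}(u)\,d\mu(u)$ for $i\ge 0$. The predictive recursion marginal likelihood is $L_n(\theta)=\prod_{i=1}^n m_{i-1,\theta}(Y_i)$. Assume: 1. $Y_1,Y_2,\ldots$ are independent with common density $m$ with respect to $\nu$, and $K(m,m_{F,\theta})<\infty$ for all $\theta\in\Theta$ and $F\in\overline{\mathbb F}$. 2. $\sum_n w_n=\infty$ and $\sum_n w_n^2<\infty$. 3. $\overline{\mathbb F}$ is compact in the weak topology. 4. For all $(y,\theta)$, the map $u\mapsto p(y\mid\theta,u)$ is bounded and continuous. 5. For each pair $(\theta_1,\theta_2)$, $\displaystyle\sup_{u_1,u_2}\int\Bigl\{\frac{p(y\mid\theta_1,u_1)}{p(y\mid\theta_2,u_2)}\Bigr\}^2 m(y)\,d\nu(y)<\infty$.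 6. For each $\theta$ there is $B_\theta<\infty$ such that $\displaystyle\int\Bigl\{\log\frac{m(y)}{m_{F,\theta}(y)}\Bigr\}^2 m(y)\,d\nu(y)\le B_\theta$ whenever $F\in\overline{\mathbb F}$ attains the infimum in $K^\star(\theta)$. Let $\Theta^\star=\{\theta\in\Theta : K^\star(\theta)=\inf_{\theta'\in\Theta} K^\star(\theta')\}$, and for each $n$ let $\hat\theta_n$ be any maximizer of $L_n$ over $\Theta$. Then, almost surely, $\hat\theta_n\in\Theta^\star$ for all sufficiently large $n$. In particular, if $\Theta^\star=\{\theta^\star\}$, then $\hat\theta_n\to\theta^\star$ almost surely. -/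

import Mathlib

open MeasureTheory ProbabilityTheory Filter Topology
open scoped ENNReal NNReal

namespace PRML

noncomputable section

variable {U 𝒴 : Type*} [MeasurableSpace U] [MeasurableSpace 𝒴]

/-- The set of mixing distributions that have a density with respect to `μ`. -/
def mixingDensities (μ : Measure U) : Set (ProbabilityMeasure U) :=
  {F | ∃ f : U → ℝ≥0∞, Measurable f ∧ (F : Measure U) = μ.withDensity f}

/-- The closure of the set of mixing densities in the topology of weak convergence of
probability measures. -/
def mixingClosure [TopologicalSpace U] [OpensMeasurableSpace U] (μ : Measure U) :
    Set (ProbabilityMeasure U) :=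
  closure (mixingDensities μ)

/-- The mixture `m_F(y) = ∫ k(y | u) dF(u)`. -/
def mixture (k : 𝒴 → U → ℝ) (F : Measure U) (y : 𝒴) : ℝ := ∫ u, k y u ∂F

/-- The Kullback--Leibler divergence `K(m, g) = ∫ log (m / g) m dν` of two probability densities
`m`, `g` with respect to `ν`, with the value `∞` allowed. -/
def KL (ν : Measure 𝒴) (m g : 𝒴 → ℝ) : ℝ≥0∞ :=
  InformationTheory.klDiv (ν.withDensity fun y => ENNReal.ofReal (m y))
    (ν.withDensity fun y => ENNReal.ofReal (g y))

/-- The smallest Kullback--Leibler divergence `inf K(m, m_F)` over the closure of the mixing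
densities, for one kernel `k`. -/
def KStar [TopologicalSpace U] [OpensMeasurableSpace U] (μ : Measure U) (ν : Measure 𝒴)
    (m : 𝒴 → ℝ) (k : 𝒴 → U → ℝ) : ℝ≥0∞ :=
  ⨅ F ∈ mixingClosure μ, KL ν m (mixture k (F : Measure U))

/-- Predictive recursion with kernel `k`, weights `w`, initial density `f₀` and data `y`.
Data and weights are numbered from `0`: the `i`-th density is the one computed from the first `i`
observations `y 0, …, y (i - 1)`, with weights `w 0, …, w (i - 1)`. -/
def prDensity (μ : Measure U) (k : 𝒴 → U → ℝ) (w : ℕ → ℝ) (f₀ : U → ℝ) (y : ℕ → 𝒴) :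
    ℕ → U → ℝ
  | 0 => f₀
  | i + 1 => fun u =>
      (1 - w i) * prDensity μ k w f₀ y i u +
        w i * (k (y i) u * prDensity μ k w f₀ y i u /
          ∫ u', k (y i) u' * prDensity μ k w f₀ y i u' ∂μ)

/-- The predictive density `m_i` at `x`, the mixture of `k` over the `i`-th density. -/
def prMixture (μ : Measure U) (k : 𝒴 → U → ℝ) (w : ℕ → ℝ) (f₀ : U → ℝ) (y : ℕ → 𝒴)
    (i : ℕ) (x : 𝒴) : ℝ :=
  ∫ u, k x u * prDensity μ k w f₀ y i u ∂μ

/-- The predictive recursion marginal likelihood of the first `n` observations: each observation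
is evaluated under the predictive density computed from the observations before it. -/
def prML (μ : Measure U) (k : 𝒴 → U → ℝ) (w : ℕ → ℝ) (f₀ : U → ℝ) (y : ℕ → 𝒴) (n : ℕ) : ℝ :=
  ∏ i ∈ Finset.range n, prMixture μ k w f₀ y i (y i)

/-- The set of minimizers over `Θ` of the smallest Kullback--Leibler divergence. -/
def ThetaStar {Θ : Type*} [TopologicalSpace U] [OpensMeasurableSpace U] (μ : Measure U)
    (ν : Measure 𝒴) (m : 𝒴 → ℝ) (p : Θ → 𝒴 → U → ℝ) : Set Θ :=
  {θ | KStar μ ν m (p θ) = ⨅ θ', KStar μ ν m (p θ')}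

end

end PRML

/-! Write `Q` for the law with density `m`, and D(F) = ∫ (log m - log m_F) dQ for the divergence of
a mixture. The heart of the matter is that, for each single kernel, the average of log m(Y_i) - log
m_i(Y_i) converges almost surely to the infimum of D over the closure. Since Θ is finite and log m
cancels when two parameters are compared, every non-minimizer is eventually beaten by a fixed
minimizer.

The engine is a uniform second-moment bound: Jensen's inequality in both numerator and denominator
carries the bound on likelihood ratios over to all ratios m_G / m_F (`lintegral_ratio_sq_le`). It
makes differences of divergences finite, controls every martingale term, and makes D upper
semicontinuous along pointwise convergent mixtures (`le_divergence_of_tendsto`).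

Two facts determine the limit of D(F_i) along the recursion. First, a step multiplies m_i(x) by 1 +
w (R - 1), where R is the cross ratio with the new observation. Expanding the logarithm, D decreases
by w times a gain whose conditional mean is nonnegative (`one_le_integral_crossRatio`), up to a
martingale difference and a summable error of order w². Hence D(F_i) converges.

Second, let G have bounded density with respect to F_0. The product of the first n update factors
has G-integral at most a constant, because F_n has mass one. Taking logarithms gives an upper bound
for ∑ w_i (m_G / m_i - 1)(Y_i) (`sum_weight_mul_ratio_le`). The conditional means of these terms
dominate w_i (D(F_i) - D(G)) by log x ≤ x - 1. As ∑ w_i diverges, lim D(F_i) ≤ D(G).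

Full support of F_0 and continuity of the kernel show that such G already realize the infimum over
the whole closure (`le_divergence_of_mem_mixingClosure`). Finally, a martingale law of large
numbers, the strong law and Cesàro averaging pass from D(F_i) to the observed log-likelihood
(`ae_tendsto_average_log`). -/

namespace PRML

set_option linter.unusedSectionVars false

/-! ### Predictable functionals of independent data -/

section Past

variable {Ω 𝒴 : Type*} [MeasurableSpace Ω] [MeasurableSpace 𝒴]

/-- The sequence that agrees with `y` before time `n` and is constantly `y₀` from time `n` on. -/
def past (y₀ : 𝒴) (n : ℕ) (y : ℕ → 𝒴) : ℕ → 𝒴 := fun j => if j < n then y j else y₀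

/-- The function `g i` of the sequence `y` only depends on the terms before time `i`. -/
def Predictable {β : Type*} (g : ℕ → (ℕ → 𝒴) → β) : Prop :=
  ∀ i y y', (∀ j < i, y j = y' j) → g i y = g i y'

lemma past_of_lt {y₀ : 𝒴} {n j : ℕ} (h : j < n) (y : ℕ → 𝒴) : past y₀ n y j = y j := by
  simp [past, h]

lemma past_past {y₀ : 𝒴} {n k : ℕ} (h : n ≤ k) (y : ℕ → 𝒴) :
    past y₀ n (past y₀ k y) = past y₀ n y := by
  funext j
  by_cases hj : j < n
  · simp [past, hj, hj.trans_le h]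
  · simp [past, hj]

lemma measurable_past (y₀ : 𝒴) (n : ℕ) : Measurable (past y₀ n) := by
  refine measurable_pi_lambda _ fun j => ?_
  by_cases hj : j < n
  · simpa [past, hj] using measurable_pi_apply j
  · simp [past, hj]

lemma Predictable.past {β : Type*} {g : ℕ → (ℕ → 𝒴) → β} (hg : Predictable g) (y₀ : 𝒴) (i : ℕ)
    (y : ℕ → 𝒴) : g i (past y₀ i y) = g i y :=
  hg i _ _ fun _ hj => past_of_lt hj y

variable {P : Measure Ω} [IsProbabilityMeasure P] {Q : Measure 𝒴} [IsProbabilityMeasure Q]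
  {Y : ℕ → Ω → 𝒴}

lemma indepFun_past (hY : ∀ i, Measurable (Y i)) (hind : iIndepFun Y P) (y₀ : 𝒴) (n : ℕ) :
    IndepFun (fun ω => past y₀ n (fun i => Y i ω)) (Y n) P := by
  have h := hind.indepFun_finset (Finset.range n) {n} (by simp) hY
  have h1 : Measurable fun (x : Finset.range n → 𝒴) (j : ℕ) =>
      if hj : j ∈ Finset.range n then x ⟨j, hj⟩ else y₀ := by
    refine measurable_pi_lambda _ fun j => ?_
    by_cases hj : j ∈ Finset.range n
    · simpa only [hj, dite_true] using measurable_pi_apply _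
    · simp only [hj, dite_false, measurable_const]
  have h2 : Measurable fun (x : ({n} : Finset ℕ) → 𝒴) => x ⟨n, by simp⟩ := measurable_pi_apply _
  have e : (fun ω => past y₀ n (fun i => Y i ω)) =
      (fun (x : Finset.range n → 𝒴) (j : ℕ) =>
        if hj : j ∈ Finset.range n then x ⟨j, hj⟩ else y₀) ∘
        fun ω (i : Finset.range n) => Y i ω := by
    funext ω j
    by_cases hj : j < n <;> simp [past, hj]
  rw [e]
  exact h.comp h1 h2

/-- This product form takes the place of conditional expectations: integrating out the last
coordinate over `Q` is conditioning on the past. -/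
lemma map_past_prod (hY : ∀ i, Measurable (Y i)) (hind : iIndepFun Y P)
    (hlaw : ∀ i, P.map (Y i) = Q) (y₀ : 𝒴) (n : ℕ) :
    P.map (fun ω => (past y₀ n (fun i => Y i ω), Y n ω)) =
      (P.map (fun ω => past y₀ n (fun i => Y i ω))).prod Q := by
  have hm : Measurable fun ω => past y₀ n (fun i => Y i ω) :=
    (measurable_past y₀ n).comp (measurable_pi_lambda _ hY)
  rw [(indepFun_iff_map_prod_eq_prod_map_map hm.aemeasurable (hY n).aemeasurable).1
    (indepFun_past hY hind y₀ n), hlaw]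

/-- A predictable function does not notice that its sequence is truncated, and the truncated
sequence is independent of the next observation. By Tonelli, a bound on all conditional means bounds
the mean. -/
lemma lintegral_predictable_le (hY : ∀ i, Measurable (Y i)) (hind : iIndepFun Y P)
    (hlaw : ∀ i, P.map (Y i) = Q) {g : ℕ → (ℕ → 𝒴) → 𝒴 → ℝ≥0∞} (hg : Predictable g)
    (hgm : ∀ i, Measurable (Function.uncurry (g i))) {C : ℝ≥0∞}
    (hC : ∀ i y, ∫⁻ x, g i y x ∂Q ≤ C) (i : ℕ) :
    ∫⁻ ω, g i (fun j => Y j ω) (Y i ω) ∂P ≤ C := by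
  obtain ⟨ω₀⟩ : Nonempty Ω := nonempty_of_isProbabilityMeasure P
  set y₀ := Y 0 ω₀
  have hm : Measurable fun ω => past y₀ i (fun i => Y i ω) :=
    (measurable_past y₀ i).comp (measurable_pi_lambda _ hY)
  have : IsProbabilityMeasure (P.map (fun ω => past y₀ i (fun i => Y i ω))) :=
    Measure.isProbabilityMeasure_map hm.aemeasurable
  calc ∫⁻ ω, g i (fun j => Y j ω) (Y i ω) ∂P
      = ∫⁻ ω, Function.uncurry (g i) (past y₀ i (fun j => Y j ω), Y i ω) ∂P := by
        simp only [Function.uncurry, hg.past]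
    _ = ∫⁻ z, Function.uncurry (g i) z ∂((P.map (fun ω => past y₀ i (fun i => Y i ω))).prod Q) := by
        rw [← map_past_prod hY hind hlaw, lintegral_map (hgm i) (hm.prodMk (hY i))]
    _ ≤ C := by
        rw [lintegral_prod _ (hgm i).aemeasurable]
        refine (lintegral_mono fun y => hC i y).trans ?_
        simp

/-- A weighted series of nonnegative terms with bounded conditional means converges. -/
lemma ae_tsum_lt_top (hY : ∀ i, Measurable (Y i)) (hind : iIndepFun Y P)
    (hlaw : ∀ i, P.map (Y i) = Q) {g : ℕ → (ℕ → 𝒴) → 𝒴 → ℝ≥0∞} (hg : Predictable g)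
    (hgm : ∀ i, Measurable (Function.uncurry (g i))) {C : ℝ≥0∞} (hCtop : C ≠ ∞)
    (hC : ∀ i y, ∫⁻ x, g i y x ∂Q ≤ C) {a : ℕ → ℝ} (ha : Summable a) :
    ∀ᵐ ω ∂P, ∑' i, ENNReal.ofReal (a i) * g i (fun j => Y j ω) (Y i ω) < ∞ := by
  have hYm : Measurable fun ω j => Y j ω := measurable_pi_lambda _ hY
  have hm : ∀ i, Measurable fun ω => ENNReal.ofReal (a i) * g i (fun j => Y j ω) (Y i ω) :=
    fun i => ((hgm i).comp (hYm.prodMk (hY i))).const_mul _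
  refine ae_lt_top (Measurable.tsum hm) ?_
  rw [lintegral_tsum fun i => (hm i).aemeasurable]
  refine ne_top_of_le_ne_top (b := (∑' i, ENNReal.ofReal (a i)) * C) ?_ ?_
  · exact ENNReal.mul_ne_top ha.tsum_ofReal_ne_top hCtop
  · rw [← ENNReal.tsum_mul_right]
    refine ENNReal.tsum_le_tsum fun i => ?_
    have hgi : Measurable fun ω => g i (fun j => Y j ω) (Y i ω) :=
      (hgm i).comp (hYm.prodMk (hY i))
    rw [lintegral_const_mul _ hgi]
    gcongr
    exact lintegral_predictable_le hY hind hlaw hg hgm hC i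

end Past

/-! ### Martingale convergence in L² and a law of large numbers -/

section Martingale

variable {Ω 𝒴 : Type*} [MeasurableSpace Ω] [MeasurableSpace 𝒴]
variable {P : Measure Ω} [IsProbabilityMeasure P] {Q : Measure 𝒴} [IsProbabilityMeasure Q]
  {Y : ℕ → Ω → 𝒴}

/-- The filtration generated by the observations before time `n`. -/
def pastFiltration (hY : ∀ i, Measurable (Y i)) (y₀ : 𝒴) : Filtration ℕ ‹MeasurableSpace Ω› where
  seq n := MeasurableSpace.comap (fun ω => past y₀ n (fun i => Y i ω)) inferInstance
  mono' n k h := by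
    have : (fun ω => past y₀ n (fun i => Y i ω)) =
        past y₀ n ∘ fun ω => past y₀ k (fun i => Y i ω) := by
      funext ω; exact (past_past h _).symm
    simp only
    rw [this, ← MeasurableSpace.comap_comp]
    exact MeasurableSpace.comap_mono (measurable_past y₀ n).comap_le
  le' n := ((measurable_past y₀ n).comp (measurable_pi_lambda _ hY)).comap_le

lemma memLp_two_of_lintegral_sq_le {α : Type*} [MeasurableSpace α] {κ : Measure α} {f : α → ℝ}
    (hf : AEStronglyMeasurable f κ) (h : ∫⁻ x, ENNReal.ofReal (f x ^ 2) ∂κ ≠ ∞) :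
    MemLp f 2 κ := by
  rw [memLp_two_iff_integrable_sq hf]
  refine ⟨hf.pow 2, ?_⟩
  rw [hasFiniteIntegral_iff_ofReal (ae_of_all _ fun x => sq_nonneg _)]
  exact h.lt_top

variable {g : ℕ → (ℕ → 𝒴) → 𝒴 → ℝ}

/-- `L²`-bounded martingale differences with square-summable weights, in the centred case. -/
lemma ae_tendsto_sum_of_centred (hY : ∀ i, Measurable (Y i)) (hind : iIndepFun Y P)
    (hlaw : ∀ i, P.map (Y i) = Q) (hg : Predictable g)
    (hgm : ∀ i, Measurable (Function.uncurry (g i))) {C : ℝ≥0}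
    (hC : ∀ i y, ∫⁻ x, ENNReal.ofReal (g i y x ^ 2) ∂Q ≤ C)
    (h0 : ∀ i y, ∫ x, g i y x ∂Q = 0) {a : ℕ → ℝ} (ha : Summable fun i => a i ^ 2) :
    ∀ᵐ ω ∂P, ∃ l, Tendsto (fun n => ∑ i ∈ Finset.range n, a i * g i (fun j => Y j ω) (Y i ω))
      atTop (𝓝 l) := by
  obtain ⟨ω₀⟩ : Nonempty Ω := nonempty_of_isProbabilityMeasure P
  set y₀ := Y 0 ω₀
  have hYm : Measurable fun ω j => Y j ω := measurable_pi_lambda _ hY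
  set ξ : ℕ → Ω → ℝ := fun i ω => g i (fun j => Y j ω) (Y i ω) with hξ
  set S : ℕ → Ω → ℝ := fun n ω => ∑ i ∈ Finset.range n, a i * ξ i ω with hS
  have hξm : ∀ i, Measurable (ξ i) := fun i => (hgm i).comp (hYm.prodMk (hY i))
  have hSm : ∀ n, Measurable (S n) := fun n =>
    Finset.measurable_sum _ fun i _ => (hξm i).const_mul _
  have hξ2 : ∀ i, ∫⁻ ω, ENNReal.ofReal (ξ i ω ^ 2) ∂P ≤ C := fun i =>
    lintegral_predictable_le hY hind hlaw (g := fun i y x => ENNReal.ofReal (g i y x ^ 2))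
      (fun i y y' h => by simp only [hg i y y' h])
      (fun i => ((hgm i).pow_const 2).ennreal_ofReal) hC i
  have hξL : ∀ i, MemLp (ξ i) 2 P := fun i =>
    memLp_two_of_lintegral_sq_le (hξm i).aestronglyMeasurable
      (ne_top_of_le_ne_top ENNReal.coe_ne_top (hξ2 i))
  have hSL : ∀ n, MemLp (S n) 2 P := fun n =>
    memLp_finsetSum _ fun i _ => (hξL i).const_mul _
  have hpm : ∀ n, Measurable fun ω => past y₀ n (fun i => Y i ω) := fun n =>
    (measurable_past y₀ n).comp hYm
  -- The n-th partial sum uses only observations with index below n, so it factors through the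
  -- truncated sequence; this is adaptedness.
  have hS_eq : ∀ n, S n = (fun y => ∑ i ∈ Finset.range n, a i * g i y (y i)) ∘
      fun ω => past y₀ n (fun i => Y i ω) := by
    intro n
    funext ω
    simp only [hS, hξ, Function.comp]
    refine Finset.sum_congr rfl fun i hi => ?_
    have hi' := Finset.mem_range.1 hi
    rw [past_of_lt hi', ← hg.past y₀ i (past y₀ n _), past_past hi'.le, hg.past]
  have hsm : ∀ n, Measurable fun y : ℕ → 𝒴 => ∑ i ∈ Finset.range n, a i * g i y (y i) := fun n =>
    Finset.measurable_sum _ fun i _ => ((hgm i).comp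
      (measurable_id.prodMk (measurable_pi_apply i))).const_mul _
  -- Increments are orthogonal to square-integrable functions of the past. Indicators for φ give the
  -- martingale property; the partial sum itself gives Pythagoras and hence the L² bound.
  have hzero : ∀ n (φ : (ℕ → 𝒴) → ℝ), Measurable φ →
      MemLp (fun ω => φ (past y₀ n (fun i => Y i ω))) 2 P →
      ∫ ω, φ (past y₀ n (fun i => Y i ω)) * ξ n ω ∂P = 0 := by
    intro n φ hφ hφL
    have hint := hφL.integrable_mul (hξL n)
    have hmap := map_past_prod hY hind hlaw y₀ n
    have : IsProbabilityMeasure (P.map (fun ω => past y₀ n (fun i => Y i ω))) :=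
      Measure.isProbabilityMeasure_map (hpm n).aemeasurable
    set Φ : (ℕ → 𝒴) × 𝒴 → ℝ := fun z => φ z.1 * g n z.1 z.2 with hΦ
    have hΦm : Measurable Φ := (hφ.comp measurable_fst).mul (hgm n)
    have heq : (fun ω => φ (past y₀ n (fun i => Y i ω)) * ξ n ω) =
        Φ ∘ fun ω => (past y₀ n (fun i => Y i ω), Y n ω) := by
      funext ω; simp only [hΦ, hξ, Function.comp, hg.past]
    have hmm : Measurable fun ω => (past y₀ n (fun i => Y i ω), Y n ω) := (hpm n).prodMk (hY n)
    have hintΦ : Integrable Φ ((P.map (fun ω => past y₀ n (fun i => Y i ω))).prod Q) := by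
      rw [← hmap, integrable_map_measure hΦm.aestronglyMeasurable hmm.aemeasurable, ← heq]
      exact hint
    calc ∫ ω, φ (past y₀ n (fun i => Y i ω)) * ξ n ω ∂P
        = ∫ z, Φ z ∂((P.map (fun ω => past y₀ n (fun i => Y i ω))).prod Q) := by
          rw [← hmap, integral_map hmm.aemeasurable hΦm.aestronglyMeasurable, heq]; rfl
      _ = 0 := by
          rw [integral_prod _ hintΦ]
          simp only [hΦ, integral_const_mul, h0, mul_zero, integral_zero]
  have hSsucc : ∀ n, S (n + 1) = fun ω => S n ω + a n * ξ n ω := by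
    intro n; funext ω; simp only [hS, Finset.sum_range_succ]
  have hmart : Martingale S (pastFiltration hY y₀) P := by
    refine martingale_of_setIntegral_eq_succ ?_ (fun n => (hSL n).integrable one_le_two) ?_
    · intro n
      rw [hS_eq n]
      refine Measurable.stronglyMeasurable ?_
      exact (hsm n).comp (comap_measurable _)
    · rintro n s ⟨B, hB, rfl⟩
      have h1 : ∫ ω in (fun ω => past y₀ n (fun i => Y i ω)) ⁻¹' B, ξ n ω ∂P = 0 := by
        rw [← integral_indicator (hpm n hB)]
        have := hzero n (B.indicator 1) (measurable_one.indicator hB) ?_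
        · rw [← this]
          congr 1; funext ω
          by_cases h : past y₀ n (fun i => Y i ω) ∈ B <;> simp [h, Set.indicator]
        · refine MemLp.of_bound (((measurable_one.indicator hB).comp
            (hpm n)).aestronglyMeasurable) 1 (ae_of_all _ fun ω => ?_)
          by_cases h : past y₀ n (fun i => Y i ω) ∈ B <;> simp [h, Set.indicator]
      rw [hSsucc n, integral_add ((hSL n).integrable one_le_two).integrableOn
        ((((hξL n).integrable one_le_two).const_mul _).integrableOn), integral_const_mul, h1]
      simp
  have hS2 : ∀ n, ∫ ω, S n ω ^ 2 ∂P ≤ (∑ i ∈ Finset.range n, a i ^ 2) * C := by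
    intro n
    induction n with
    | zero => simp [hS]
    | succ n ih =>
      have h1 : ∫ ω, ξ n ω ^ 2 ∂P ≤ C := by
        rw [integral_eq_lintegral_of_nonneg_ae (ae_of_all _ fun _ => sq_nonneg _)
          ((hξm n).pow_const 2).aestronglyMeasurable]
        exact ENNReal.toReal_le_coe_of_le_coe (hξ2 n)
      have h2 : ∫ ω, S n ω * ξ n ω ∂P = 0 := by
        have := hzero n _ (hsm n) (by have := hSL n; rw [hS_eq n] at this; exact this)
        rw [hS_eq n]; exact this
      have h3 : ∫ ω, S (n + 1) ω ^ 2 ∂P = ∫ ω, S n ω ^ 2 ∂P + a n ^ 2 * ∫ ω, ξ n ω ^ 2 ∂P := by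
        have e : (fun ω => S (n + 1) ω ^ 2) = fun ω =>
            (S n ω ^ 2 + 2 * a n * (S n ω * ξ n ω)) + a n ^ 2 * ξ n ω ^ 2 := by
          funext ω; rw [hSsucc n]; ring
        have i1 := (hSL n).integrable_sq
        have i2 : Integrable (fun ω => S n ω * ξ n ω) P := (hSL n).integrable_mul (hξL n)
        have i3 := (hξL n).integrable_sq
        have i4 : Integrable (fun ω => S n ω ^ 2 + 2 * a n * (S n ω * ξ n ω)) P :=
          i1.add (i2.const_mul _)
        rw [e, integral_add i4 (i3.const_mul _),
          integral_add i1 (i2.const_mul _), integral_const_mul, integral_const_mul, h2]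
        ring
      rw [h3, Finset.sum_range_succ, add_mul]
      gcongr
  set R : ℝ≥0 := (1 + (∑' i, a i ^ 2) * C).toNNReal
  have hbdd : ∀ n, eLpNorm (S n) 1 P ≤ R := by
    intro n
    rw [eLpNorm_one_eq_lintegral_enorm]
    have : ∫ ω, ‖S n ω‖ ∂P ≤ 1 + (∑' i, a i ^ 2) * C := by
      calc ∫ ω, ‖S n ω‖ ∂P ≤ ∫ ω, (1 + S n ω ^ 2) ∂P := by
            refine integral_mono ((hSL n).integrable one_le_two).norm
              ((integrable_const _).add (hSL n).integrable_sq) fun ω => ?_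
            simp only [Real.norm_eq_abs]
            nlinarith [sq_nonneg (|S n ω| - 1), sq_abs (S n ω)]
        _ = 1 + ∫ ω, S n ω ^ 2 ∂P := by
            rw [integral_add (integrable_const _) (hSL n).integrable_sq]; simp
        _ ≤ 1 + (∑' i, a i ^ 2) * C := by
            gcongr
            refine (hS2 n).trans ?_
            gcongr
            exact ha.sum_le_tsum _ fun _ _ => sq_nonneg _
    rw [← ofReal_integral_norm_eq_lintegral_enorm ((hSL n).integrable one_le_two)]
    exact ENNReal.ofReal_le_ofReal this
  exact hmart.submartingale.exists_ae_tendsto_of_bdd hbdd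

/-- Weighted sums of square-integrable functions of the next observation, centred at their
conditional means, converge almost surely if the weights are square-summable. -/
lemma ae_tendsto_sum_sub_integral (hY : ∀ i, Measurable (Y i)) (hind : iIndepFun Y P)
    (hlaw : ∀ i, P.map (Y i) = Q) (hg : Predictable g)
    (hgm : ∀ i, Measurable (Function.uncurry (g i))) {C : ℝ≥0}
    (hC : ∀ i y, ∫⁻ x, ENNReal.ofReal (g i y x ^ 2) ∂Q ≤ C)
    {a : ℕ → ℝ} (ha : Summable fun i => a i ^ 2) :
    ∀ᵐ ω ∂P, ∃ l, Tendsto (fun n => ∑ i ∈ Finset.range n,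
      a i * (g i (fun j => Y j ω) (Y i ω) - ∫ x, g i (fun j => Y j ω) x ∂Q)) atTop (𝓝 l) := by
  have hL : ∀ i y, MemLp (g i y) 2 Q := fun i y =>
    memLp_two_of_lintegral_sq_le ((hgm i).comp measurable_prodMk_left).aestronglyMeasurable
      (ne_top_of_le_ne_top ENNReal.coe_ne_top (hC i y))
  refine ae_tendsto_sum_of_centred (g := fun i y x => g i y x - ∫ x, g i y x ∂Q) (C := C)
    hY hind hlaw ?_ ?_ ?_ ?_ ha
  · intro i y y' h
    simp only [hg i y y' h]
  · intro i
    exact (hgm i).sub ((hgm i).stronglyMeasurable.integral_prod_right.measurable.comp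
      measurable_fst)
  · intro i y
    have i1 := (hL i y).integrable_sq
    have i0 := (hL i y).integrable one_le_two
    have i2 : Integrable (fun x => (g i y x - ∫ x, g i y x ∂Q) ^ 2) Q :=
      ((hL i y).sub (memLp_const _)).integrable_sq
    rw [← ofReal_integral_eq_lintegral_ofReal i2 (ae_of_all _ fun _ => sq_nonneg _)]
    have hle := hC i y
    rw [← ofReal_integral_eq_lintegral_ofReal i1 (ae_of_all _ fun _ => sq_nonneg _)] at hle
    refine le_trans (ENNReal.ofReal_le_ofReal ?_) hle
    have e : (fun x => (g i y x - ∫ x, g i y x ∂Q) ^ 2) = fun x =>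
        (g i y x ^ 2 - 2 * (∫ x, g i y x ∂Q) * g i y x) + (∫ x, g i y x ∂Q) ^ 2 := by
      funext x; ring
    have i3 : Integrable (fun x => g i y x ^ 2 - 2 * (∫ x, g i y x ∂Q) * g i y x) Q :=
      i1.sub (i0.const_mul _)
    rw [e, integral_add i3 (integrable_const _),
      integral_sub i1 (i0.const_mul _), integral_const_mul]
    simp only [integral_const, probReal_univ, one_smul]
    nlinarith [sq_nonneg (∫ x, g i y x ∂Q)]
  · intro i y
    rw [integral_sub ((hL i y).integrable one_le_two) (integrable_const _)]
    simp

/-- Kronecker's lemma for the weights `1 / (i + 1)`. -/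
lemma tendsto_average_of_tendsto_sum_div {x : ℕ → ℝ} {l : ℝ}
    (h : Tendsto (fun n => ∑ i ∈ Finset.range n, (i + 1 : ℝ)⁻¹ * x i) atTop (𝓝 l)) :
    Tendsto (fun n : ℕ => (n : ℝ)⁻¹ * ∑ i ∈ Finset.range n, x i) atTop (𝓝 0) := by
  set s : ℕ → ℝ := fun n => ∑ i ∈ Finset.range n, (i + 1 : ℝ)⁻¹ * x i with hs
  -- Abel summation. After division by n this is a convergent sequence minus its Cesàro means.
  have key : ∀ n : ℕ, ∑ i ∈ Finset.range n, x i = n * s n - ∑ i ∈ Finset.range n, s i := by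
    intro n
    induction n with
    | zero => simp
    | succ n ih =>
      have h1 : s (n + 1) = s n + (n + 1 : ℝ)⁻¹ * x n := by simp only [hs, Finset.sum_range_succ]
      have h2 : (n + 1 : ℝ) ≠ 0 := by positivity
      rw [Finset.sum_range_succ, Finset.sum_range_succ, ih, h1]
      push_cast
      field_simp
      ring
  have h2 := h.sub h.cesaro
  rw [sub_self] at h2
  refine h2.congr' ?_
  filter_upwards [eventually_gt_atTop 0] with n hn
  have : (n : ℝ) ≠ 0 := by positivity
  rw [key, mul_sub, inv_mul_cancel_left₀ this]

lemma summable_sq_inv_succ : Summable fun i : ℕ => ((i + 1 : ℝ)⁻¹) ^ 2 := by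
  have := (summable_nat_add_iff 1).2 (Real.summable_nat_pow_inv (p := 2) |>.2 one_lt_two)
  simpa [inv_pow] using this

/-- The law of large numbers for square-integrable functions of the next observation. -/
lemma ae_tendsto_average_sub_integral (hY : ∀ i, Measurable (Y i)) (hind : iIndepFun Y P)
    (hlaw : ∀ i, P.map (Y i) = Q) (hg : Predictable g)
    (hgm : ∀ i, Measurable (Function.uncurry (g i))) {C : ℝ≥0}
    (hC : ∀ i y, ∫⁻ x, ENNReal.ofReal (g i y x ^ 2) ∂Q ≤ C) :
    ∀ᵐ ω ∂P, Tendsto (fun n : ℕ => (n : ℝ)⁻¹ * ∑ i ∈ Finset.range n,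
      (g i (fun j => Y j ω) (Y i ω) - ∫ x, g i (fun j => Y j ω) x ∂Q)) atTop (𝓝 0) := by
  filter_upwards [ae_tendsto_sum_sub_integral hY hind hlaw hg hgm hC summable_sq_inv_succ]
    with ω ⟨l, hl⟩
  exact tendsto_average_of_tendsto_sum_div hl

end Martingale

/-! ### Jensen's inequality for the square and the inverse square -/

section Jensen

variable {U : Type*} [MeasurableSpace U]

lemma ennreal_two_mul_le_add_sq {a b : ℝ≥0∞} (ha : a ≠ ∞) : 2 * a * b ≤ b ^ 2 + a ^ 2 := by
  lift a to ℝ≥0 using ha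
  induction b with
  | top => simp
  | coe b =>
    norm_cast
    have := two_mul_le_add_sq b a
    calc 2 * a * b = 2 * b * a := by ring
      _ ≤ _ := this

/-- Integrate 2 a f ≤ f² + a² with a the mean of f, then cancel a². -/
lemma sq_lintegral_le {F : Measure U} [IsProbabilityMeasure F] {f : U → ℝ≥0∞}
    (hf : Measurable f) : (∫⁻ u, f u ∂F) ^ 2 ≤ ∫⁻ u, f u ^ 2 ∂F := by
  by_cases h2 : ∫⁻ u, f u ^ 2 ∂F = ∞
  · simp [h2]
  have h1 : ∫⁻ u, f u ∂F ≠ ∞ := by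
    refine ne_top_of_le_ne_top (b := ∫⁻ u, (f u ^ 2 + 1) ∂F) ?_ (lintegral_mono fun u => ?_)
    · rw [lintegral_add_right _ measurable_const]
      simp [h2]
    · have := ennreal_two_mul_le_add_sq (a := 1) (b := f u) ENNReal.one_ne_top
      simp only [mul_one, one_pow] at this
      refine le_trans ?_ this
      exact le_mul_of_one_le_left zero_le one_le_two
  set a := ∫⁻ u, f u ∂F with ha
  have h3 : 2 * a * a ≤ ∫⁻ u, f u ^ 2 ∂F + a ^ 2 := by
    calc 2 * a * a = ∫⁻ u, 2 * a * f u ∂F := by rw [lintegral_const_mul _ hf]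
      _ ≤ ∫⁻ u, (f u ^ 2 + a ^ 2) ∂F := lintegral_mono fun u => ennreal_two_mul_le_add_sq h1
      _ = _ := by rw [lintegral_add_right _ measurable_const]; simp
  have h4 : 2 * a * a = a ^ 2 + a ^ 2 := by ring
  rw [h4] at h3
  exact (ENNReal.add_le_add_iff_right (ENNReal.pow_ne_top h1)).1 h3

/-- The tangent to x ↦ (b / x)² at a lies below the graph. Written without subtraction, and with t =
x / a, this is 3 ≤ t⁻² + 2t. -/
lemma three_mul_div_sq_le {a b x : ℝ≥0∞} (ha0 : a ≠ 0) (ha : a ≠ ∞) (hb : b ≠ ∞) :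
    3 * (b / a) ^ 2 ≤ (b / x) ^ 2 + 2 * (b / a) ^ 2 * (x / a) := by
  by_cases hb0 : b = 0
  · simp [hb0]
  by_cases hx0 : x = 0
  · simp [hx0, ENNReal.div_zero hb0]
  by_cases hx : x = ∞
  · have : (b / a) ^ 2 ≠ 0 := by simp [hb0, ha]
    simp [hx, ENNReal.top_div, ha, this, ENNReal.mul_top]
  lift a to ℝ≥0 using ha
  lift b to ℝ≥0 using hb
  lift x to ℝ≥0 using hx
  have ha0' : a ≠ 0 := by simpa using ha0
  have hx0' : x ≠ 0 := by simpa using hx0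
  rw [← ENNReal.coe_div ha0', ← ENNReal.coe_div hx0', ← ENNReal.coe_div ha0']
  norm_cast
  rw [← NNReal.coe_le_coe]
  push_cast
  have hapos : (0 : ℝ) < a := by positivity
  have hxpos : (0 : ℝ) < x := by positivity
  set t : ℝ := x / a with ht
  have htpos : 0 < t := by positivity
  have h1 : (b / x : ℝ) = (b / a) / t := by rw [ht]; field_simp
  rw [h1]
  set s : ℝ := b / a
  have h2 : (3 : ℝ) ≤ 1 / t ^ 2 + 2 * t := by
    rw [← sub_nonneg]
    have : 1 / t ^ 2 + 2 * t - 3 = (t - 1) ^ 2 * (2 * t + 1) / t ^ 2 := by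
      field_simp; ring
    rw [this]; positivity
  calc 3 * s ^ 2 ≤ (1 / t ^ 2 + 2 * t) * s ^ 2 := by gcongr
    _ = _ := by ring

/-- The tangent inequality is taken at the mean and integrated; there x / a has integral one, so two
of the three copies cancel. -/
lemma div_lintegral_sq_le {F : Measure U} [IsProbabilityMeasure F] {x : U → ℝ≥0∞}
    (hx : Measurable x) {b : ℝ≥0∞} (hb : b ≠ ∞) (h0 : ∫⁻ u, x u ∂F ≠ 0)
    (h1 : ∫⁻ u, x u ∂F ≠ ∞) : (b / ∫⁻ u, x u ∂F) ^ 2 ≤ ∫⁻ u, (b / x u) ^ 2 ∂F := by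
  set a := ∫⁻ u, x u ∂F with ha
  have key : 3 * (b / a) ^ 2 ≤ ∫⁻ u, (b / x u) ^ 2 ∂F + 2 * (b / a) ^ 2 := by
    calc 3 * (b / a) ^ 2 = ∫⁻ _, 3 * (b / a) ^ 2 ∂F := by simp
      _ ≤ ∫⁻ u, ((b / x u) ^ 2 + 2 * (b / a) ^ 2 * (x u / a)) ∂F :=
        lintegral_mono fun u => three_mul_div_sq_le h0 h1 hb
      _ = _ := by
        rw [lintegral_add_right _ ((hx.div_const _).const_mul _),
          lintegral_const_mul _ (hx.div_const _)]
        simp only [div_eq_mul_inv]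
        rw [lintegral_mul_const _ hx, ← ha, ENNReal.mul_inv_cancel h0 h1, mul_one]
  have e : 3 * (b / a) ^ 2 = (b / a) ^ 2 + 2 * (b / a) ^ 2 := by ring
  rw [e] at key
  have : 2 * (b / a) ^ 2 ≠ ∞ :=
    ENNReal.mul_ne_top (by simp) (ENNReal.pow_ne_top (ENNReal.div_ne_top hb h0))
  exact (ENNReal.add_le_add_iff_right this).1 key

end Jensen

/-! ### Regular kernels: moment bounds and semicontinuity of the divergence -/

variable {U 𝒴 : Type*} [MeasurableSpace U] [MeasurableSpace 𝒴]

/-- A jointly measurable kernel, bounded in the mixing variable, almost everywhere positive, whose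
likelihood ratios are uniformly square-integrable. -/
structure RegularKernel (Q : Measure 𝒴) (k : 𝒴 → U → ℝ) (A : ℝ≥0) : Prop where
  meas : Measurable (Function.uncurry k)
  nonneg : ∀ y u, 0 ≤ k y u
  bdd : ∀ y, ∃ C : ℝ, ∀ u, k y u ≤ C
  pos : ∀ u, ∀ᵐ y ∂Q, 0 < k y u
  ratio : ∀ u₁ u₂, ∫⁻ y, (ENNReal.ofReal (k y u₁) / ENNReal.ofReal (k y u₂)) ^ 2 ∂Q ≤ A

/-- The integral of `c - log m_F`; for `c = log m` it is the Kullback--Leibler divergence. -/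
noncomputable def divergence (Q : Measure 𝒴) (c : 𝒴 → ℝ) (k : 𝒴 → U → ℝ) (F : Measure U) : ℝ :=
  ∫ y, (c y - Real.log (mixture k F y)) ∂Q

/-- Bounds on a ratio and on its inverse thus control the logarithm; log x ≤ x - 1 is used at x or
at 1 / x, according to the sign. -/
lemma log_sq_le {x : ℝ} (hx : 0 < x) : Real.log x ^ 2 ≤ x ^ 2 + x⁻¹ ^ 2 := by
  have h1 := Real.log_le_sub_one_of_pos hx
  have h2 := Real.log_le_sub_one_of_pos (inv_pos.2 hx)
  rw [Real.log_inv] at h2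
  have h3 := inv_pos.2 hx
  rcases le_total 0 (Real.log x) with h | h
  · nlinarith [sq_nonneg x⁻¹]
  · nlinarith [sq_nonneg x]

namespace RegularKernel

variable {Q : Measure 𝒴} [IsProbabilityMeasure Q] {k : 𝒴 → U → ℝ} {A : ℝ≥0}

lemma meas_right (hk : RegularKernel Q k A) (y : 𝒴) : Measurable (k y) :=
  hk.meas.comp measurable_prodMk_left

lemma integrable (hk : RegularKernel Q k A) (F : Measure U) [IsFiniteMeasure F] (y : 𝒴) :
    Integrable (k y) F := by
  obtain ⟨C, hC⟩ := hk.bdd y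
  refine Integrable.of_bound (hk.meas_right y).aestronglyMeasurable C (ae_of_all _ fun u => ?_)
  rw [Real.norm_eq_abs, abs_of_nonneg (hk.nonneg y u)]
  exact hC u

lemma ofReal_mixture (hk : RegularKernel Q k A) (F : Measure U) [IsFiniteMeasure F] (y : 𝒴) :
    ENNReal.ofReal (mixture k F y) = ∫⁻ u, ENNReal.ofReal (k y u) ∂F :=
  ofReal_integral_eq_lintegral_ofReal (hk.integrable F y) (ae_of_all _ (hk.nonneg y))

lemma measurable_mixture (hk : RegularKernel Q k A) (F : Measure U) [SFinite F] :
    Measurable (mixture k F) :=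
  hk.meas.stronglyMeasurable.integral_prod_right.measurable

lemma mixture_nonneg (hk : RegularKernel Q k A) (F : Measure U) (y : 𝒴) : 0 ≤ mixture k F y :=
  integral_nonneg (hk.nonneg y)

lemma mixture_pos_of_ae (hk : RegularKernel Q k A) (F : Measure U) [IsProbabilityMeasure F]
    {y : 𝒴} (h : ∀ᵐ u ∂F, 0 < k y u) : 0 < mixture k F y := by
  rw [mixture, integral_pos_iff_support_of_nonneg (hk.nonneg y) (hk.integrable F y)]
  have : F (Function.support (k y)) = 1 := by
    have hms : MeasurableSet (Function.support (k y)) := measurableSet_support (hk.meas_right y)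
    rw [← prob_compl_eq_zero_iff hms]
    refine measure_mono_null (fun u hu => ?_) (ae_iff.1 h)
    simp only [Function.support, Set.mem_compl_iff, Set.mem_ofPred_eq, not_not] at hu
    simp [hu]
  simp [this]

lemma mixture_pos (hk : RegularKernel Q k A) (F : Measure U) [IsProbabilityMeasure F] :
    ∀ᵐ y ∂Q, 0 < mixture k F y := by
  have h1 : MeasurableSet {z : U × 𝒴 | 0 < k z.2 z.1} :=
    measurableSet_lt measurable_const (hk.meas.comp measurable_swap)
  have h : ∀ᵐ z ∂(F.prod Q), 0 < k z.2 z.1 := by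
    rw [Measure.ae_prod_iff_ae_ae h1]
    exact ae_of_all _ hk.pos
  have h2 : ∀ᵐ z ∂(Q.prod F), 0 < k z.1 z.2 := by
    have h3 : MeasurableSet {z : 𝒴 × U | 0 < k z.1 z.2} :=
      measurableSet_lt measurable_const hk.meas
    rw [← Measure.prod_swap, ae_map_iff measurable_swap.aemeasurable h3]
    exact h
  filter_upwards [Measure.ae_ae_of_ae_prod h2] with y hy
  exact hk.mixture_pos_of_ae F hy

/-- The ratio (∫ a dG / ∫ b dF)² is at most ∬ (a / b)² dF dG: the square is convex in the numerator
and the inverse square in the denominator. Tonelli then reduces to ratios of the kernel at two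
points. The bound does not depend on `F` or `G`. -/
lemma lintegral_ratio_sq_le (hk : RegularKernel Q k A) (F G : Measure U) [IsProbabilityMeasure F]
    [IsProbabilityMeasure G] :
    ∫⁻ y, ENNReal.ofReal ((mixture k G y / mixture k F y) ^ 2) ∂Q ≤ A := by
  have hm : ∀ y, Measurable fun u => ENNReal.ofReal (k y u) :=
    fun y => (hk.meas_right y).ennreal_ofReal
  have hpt : ∀ y, ENNReal.ofReal ((mixture k G y / mixture k F y) ^ 2) ≤
      ∫⁻ u, ∫⁻ v, (ENNReal.ofReal (k y u) / ENNReal.ofReal (k y v)) ^ 2 ∂F ∂G := by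
    intro y
    rcases (hk.mixture_nonneg F y).eq_or_lt with h0 | h0
    · simp [← h0]
    have ha0 : ∫⁻ v, ENNReal.ofReal (k y v) ∂F ≠ 0 := by
      rw [← hk.ofReal_mixture]; simpa using h0
    have ha1 : ∫⁻ v, ENNReal.ofReal (k y v) ∂F ≠ ∞ := by
      rw [← hk.ofReal_mixture]; simp
    calc ENNReal.ofReal ((mixture k G y / mixture k F y) ^ 2)
        = (∫⁻ u, ENNReal.ofReal (k y u) / (∫⁻ v, ENNReal.ofReal (k y v) ∂F) ∂G) ^ 2 := by
          rw [ENNReal.ofReal_pow (div_nonneg (hk.mixture_nonneg G y) h0.le),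
            ENNReal.ofReal_div_of_pos h0, hk.ofReal_mixture, hk.ofReal_mixture]
          simp only [div_eq_mul_inv]
          rw [lintegral_mul_const _ (hm y)]
      _ ≤ ∫⁻ u, (ENNReal.ofReal (k y u) / (∫⁻ v, ENNReal.ofReal (k y v) ∂F)) ^ 2 ∂G :=
          sq_lintegral_le ((hm y).div_const _)
      _ ≤ _ := lintegral_mono fun u =>
          div_lintegral_sq_le (hm y) ENNReal.ofReal_ne_top ha0 ha1
  have hM : Measurable fun z : (𝒴 × U) × U =>
      (ENNReal.ofReal (k z.1.1 z.1.2) / ENNReal.ofReal (k z.1.1 z.2)) ^ 2 :=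
    (((hk.meas.comp measurable_fst).ennreal_ofReal).div
      ((hk.meas.comp ((measurable_fst.comp measurable_fst).prodMk
        measurable_snd)).ennreal_ofReal)).pow_const 2
  calc ∫⁻ y, ENNReal.ofReal ((mixture k G y / mixture k F y) ^ 2) ∂Q
      ≤ ∫⁻ y, ∫⁻ u, ∫⁻ v, (ENNReal.ofReal (k y u) / ENNReal.ofReal (k y v)) ^ 2 ∂F ∂G ∂Q :=
        lintegral_mono hpt
    _ = ∫⁻ u, ∫⁻ y, ∫⁻ v, (ENNReal.ofReal (k y u) / ENNReal.ofReal (k y v)) ^ 2 ∂F ∂Q ∂G :=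
        lintegral_lintegral_swap (hM.lintegral_prod_right' (ν := F)).aemeasurable
    _ = ∫⁻ u, ∫⁻ v, ∫⁻ y, (ENNReal.ofReal (k y u) / ENNReal.ofReal (k y v)) ^ 2 ∂Q ∂F ∂G := by
        refine lintegral_congr fun u => lintegral_lintegral_swap ?_
        exact (hM.comp ((measurable_fst.prodMk measurable_const).prodMk
          measurable_snd)).aemeasurable
    _ ≤ ∫⁻ _, ∫⁻ _, A ∂F ∂G := by
        gcongr with u v; exact hk.ratio u v
    _ = A := by simp

lemma memLp_ratio (hk : RegularKernel Q k A) (F G : Measure U) [IsProbabilityMeasure F]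
    [IsProbabilityMeasure G] : MemLp (fun y => mixture k G y / mixture k F y) 2 Q :=
  memLp_two_of_lintegral_sq_le
    ((hk.measurable_mixture G).div (hk.measurable_mixture F)).aestronglyMeasurable
    (ne_top_of_le_ne_top ENNReal.coe_ne_top (hk.lintegral_ratio_sq_le F G))

lemma integrable_ratio (hk : RegularKernel Q k A) (F G : Measure U) [IsProbabilityMeasure F]
    [IsProbabilityMeasure G] : Integrable (fun y => mixture k G y / mixture k F y) Q :=
  (hk.memLp_ratio F G).integrable one_le_two

lemma integral_ratio_sq_le (hk : RegularKernel Q k A) (F G : Measure U) [IsProbabilityMeasure F]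
    [IsProbabilityMeasure G] : ∫ y, (mixture k G y / mixture k F y) ^ 2 ∂Q ≤ A := by
  rw [integral_eq_lintegral_of_nonneg_ae (ae_of_all _ fun _ => sq_nonneg _)
    (hk.memLp_ratio F G).integrable_sq.aestronglyMeasurable]
  exact ENNReal.toReal_le_coe_of_le_coe (hk.lintegral_ratio_sq_le F G)

lemma lintegral_log_ratio_sq_le (hk : RegularKernel Q k A) (F G : Measure U)
    [IsProbabilityMeasure F] [IsProbabilityMeasure G] :
    ∫⁻ y, ENNReal.ofReal (Real.log (mixture k G y / mixture k F y) ^ 2) ∂Q ≤ (2 * A : ℝ≥0) := by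
  calc ∫⁻ y, ENNReal.ofReal (Real.log (mixture k G y / mixture k F y) ^ 2) ∂Q
      ≤ ∫⁻ y, (ENNReal.ofReal ((mixture k G y / mixture k F y) ^ 2) +
          ENNReal.ofReal ((mixture k F y / mixture k G y) ^ 2)) ∂Q := by
        refine lintegral_mono_ae ?_
        filter_upwards [hk.mixture_pos F, hk.mixture_pos G] with y h1 h2
        rw [← ENNReal.ofReal_add (sq_nonneg _) (sq_nonneg _)]
        refine ENNReal.ofReal_le_ofReal ?_
        have := log_sq_le (div_pos h2 h1)
        rwa [inv_div] at this
    _ ≤ A + A := by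
        rw [lintegral_add_left]
        · exact add_le_add (hk.lintegral_ratio_sq_le F G) (hk.lintegral_ratio_sq_le G F)
        · exact (((hk.measurable_mixture G).div (hk.measurable_mixture F)).pow_const 2).ennreal_ofReal
    _ = _ := by push_cast; ring

lemma integrable_log_ratio (hk : RegularKernel Q k A) (F G : Measure U)
    [IsProbabilityMeasure F] [IsProbabilityMeasure G] :
    Integrable (fun y => Real.log (mixture k G y / mixture k F y)) Q :=
  (memLp_two_of_lintegral_sq_le
    ((hk.measurable_mixture G).div (hk.measurable_mixture F)).log.aestronglyMeasurable
    (ne_top_of_le_ne_top ENNReal.coe_ne_top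
      (hk.lintegral_log_ratio_sq_le F G))).integrable one_le_two

variable {c : 𝒴 → ℝ}

lemma sub_log_ae_eq (hk : RegularKernel Q k A) (F G : Measure U)
    [IsProbabilityMeasure F] [IsProbabilityMeasure G] :
    (fun y => c y - Real.log (mixture k F y)) =ᵐ[Q] fun y =>
      (c y - Real.log (mixture k G y)) + Real.log (mixture k G y / mixture k F y) := by
  filter_upwards [hk.mixture_pos F, hk.mixture_pos G] with y h1 h2
  rw [Real.log_div h2.ne' h1.ne']
  ring

lemma integrable_sub_log (hk : RegularKernel Q k A) (G : Measure U) [IsProbabilityMeasure G]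
    (hc : Integrable (fun y => c y - Real.log (mixture k G y)) Q) (F : Measure U)
    [IsProbabilityMeasure F] :
    Integrable (fun y => c y - Real.log (mixture k F y)) Q :=
  (hc.add (hk.integrable_log_ratio F G)).congr (hk.sub_log_ae_eq F G).symm

/-- Log-ratios of mixtures are always integrable, so finiteness of the divergence at one mixing
distribution suffices to compare any two. -/
lemma divergence_eq_add (hk : RegularKernel Q k A) (F G : Measure U)
    [IsProbabilityMeasure F] [IsProbabilityMeasure G]
    (hc : Integrable (fun y => c y - Real.log (mixture k G y)) Q) :
    divergence Q c k F = divergence Q c k G +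
      ∫ y, Real.log (mixture k G y / mixture k F y) ∂Q := by
  rw [divergence, integral_congr_ae (hk.sub_log_ae_eq F G),
    integral_add hc (hk.integrable_log_ratio F G), divergence]

lemma integral_log_ratio_le (hk : RegularKernel Q k A) (F G : Measure U)
    [IsProbabilityMeasure F] [IsProbabilityMeasure G] :
    ∫ y, Real.log (mixture k G y / mixture k F y) ∂Q ≤
      ∫ y, mixture k G y / mixture k F y ∂Q - 1 := by
  have : ∫ y, mixture k G y / mixture k F y ∂Q - 1 =
      ∫ y, (mixture k G y / mixture k F y - 1) ∂Q := by
    rw [integral_sub (hk.integrable_ratio F G) (integrable_const _)]; simp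
  rw [this]
  refine integral_mono_ae (hk.integrable_log_ratio F G)
    ((hk.integrable_ratio F G).sub (integrable_const _)) ?_
  filter_upwards [hk.mixture_pos F, hk.mixture_pos G] with y h1 h2
  exact Real.log_le_sub_one_of_pos (div_pos h2 h1)

/-- Lower bounds on the divergence pass to limits along which the mixtures converge pointwise. -/
lemma le_divergence_of_tendsto (hk : RegularKernel Q k A) {F : Measure U} [IsProbabilityMeasure F]
    {G : ℕ → Measure U} [∀ n, IsProbabilityMeasure (G n)]
    (hc : Integrable (fun y => c y - Real.log (mixture k F y)) Q)
    (hG : ∀ y, Tendsto (fun n => mixture k (G n) y) atTop (𝓝 (mixture k F y)))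
    {a : ℝ} (ha : ∀ n, a ≤ divergence Q c k (G n)) : a ≤ divergence Q c k F := by
  set X : ℕ → 𝒴 → ℝ := fun n y => mixture k F y / mixture k (G n) y with hX
  have hX0 : ∀ n y, 0 ≤ X n y := fun n y =>
    div_nonneg (hk.mixture_nonneg _ _) (hk.mixture_nonneg _ _)
  have hXm : ∀ n, Measurable (X n) := fun n =>
    (hk.measurable_mixture F).div (hk.measurable_mixture (G n))
  have hX1 : ∀ᵐ y ∂Q, Tendsto (fun n => X n y) atTop (𝓝 1) := by
    filter_upwards [hk.mixture_pos F] with y hy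
    have := (tendsto_const_nhds (x := mixture k F y)).div (hG y) hy.ne'
    rwa [div_self hy.ne'] at this
  -- The increase of the divergence from `F` to `G n` is at most ∫ X n - 1. Truncating at `M` allows
  -- dominated convergence, and costs at most A / M because X ≤ min(X, M) + X² / M.
  have key : ∀ M : ℝ, 1 ≤ M → a ≤ divergence Q c k F + (A : ℝ) / M := by
    intro M hM
    have hMpos : 0 < M := by linarith
    have hmin : ∀ n, Integrable (fun y => min (X n y) M) Q := fun n => by
      refine Integrable.of_bound ((hXm n).min measurable_const).aestronglyMeasurable M
        (ae_of_all _ fun y => ?_)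
      rw [Real.norm_eq_abs, abs_of_nonneg (le_min (hX0 n y) hMpos.le)]
      exact min_le_right _ _
    have hlim : Tendsto (fun n => ∫ y, min (X n y) M ∂Q) atTop (𝓝 1) := by
      have := tendsto_integral_of_dominated_convergence (μ := Q) (F := fun n y => min (X n y) M)
        (f := fun _ => 1) (fun _ => M) (fun n => (hmin n).aestronglyMeasurable)
        (integrable_const _) (fun n => ae_of_all _ fun y => by
          rw [Real.norm_eq_abs, abs_of_nonneg (le_min (hX0 n y) hMpos.le)]
          exact min_le_right _ _) (by
          filter_upwards [hX1] with y hy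
          have := hy.min (tendsto_const_nhds (x := M))
          rwa [min_eq_left hM] at this)
      simpa using this
    have hb : ∀ n, a ≤ divergence Q c k F + (∫ y, min (X n y) M ∂Q + A / M - 1) := by
      intro n
      have h1 := ha n
      rw [hk.divergence_eq_add (G n) F hc] at h1
      have h2 := hk.integral_log_ratio_le (G n) F
      have h3 : ∫ y, X n y ∂Q ≤ ∫ y, min (X n y) M ∂Q + A / M := by
        calc ∫ y, X n y ∂Q ≤ ∫ y, (min (X n y) M + X n y ^ 2 / M) ∂Q := by
              refine integral_mono (hk.integrable_ratio (G n) F)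
                ((hmin n).add ((hk.memLp_ratio (G n) F).integrable_sq.div_const M)) fun y => ?_
              simp only
              rcases le_total (X n y) M with h | h
              · rw [min_eq_left h]
                have : 0 ≤ X n y ^ 2 / M := by positivity
                linarith
              · have : X n y ≤ X n y ^ 2 / M := by
                  rw [le_div_iff₀ hMpos]; nlinarith [hX0 n y]
                rw [min_eq_right h]; linarith
          _ = ∫ y, min (X n y) M ∂Q + (∫ y, X n y ^ 2 ∂Q) / M := by
              rw [integral_add (hmin n) ((hk.memLp_ratio (G n) F).integrable_sq.div_const M),
                integral_div]
          _ ≤ _ := by gcongr; exact hk.integral_ratio_sq_le (G n) F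
      linarith
    have hl : Tendsto (fun n => divergence Q c k F + (∫ y, min (X n y) M ∂Q + A / M - 1)) atTop
        (𝓝 (divergence Q c k F + (1 + A / M - 1))) :=
      tendsto_const_nhds.add ((hlim.add tendsto_const_nhds).sub tendsto_const_nhds)
    have := ge_of_tendsto' hl hb
    linarith
  have hl : Tendsto (fun M : ℝ => divergence Q c k F + (A : ℝ) / M) atTop
      (𝓝 (divergence Q c k F + 0)) :=
    tendsto_const_nhds.add (tendsto_const_nhds.div_atTop tendsto_id)
  rw [add_zero] at hl
  exact ge_of_tendsto hl ((eventually_ge_atTop 1).mono key)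

end RegularKernel

/-! ### Reduction of the infimum to bounded densities -/

section

/-- Averages of a continuous function over shrinking balls converge to the value at the centre. -/
lemma tendsto_lintegral_cond_ball {X : Type*} [MetricSpace X] [MeasurableSpace X] [BorelSpace X]
    {F : Measure X} [IsProbabilityMeasure F] {x : X}
    (hx : ∀ r > 0, F (Metric.ball x r) ≠ 0) {f : X → ℝ} (hf : Continuous f) :
    Tendsto (fun n : ℕ => ∫⁻ u, ENNReal.ofReal (f u) ∂(cond F (Metric.ball x (n + 1 : ℝ)⁻¹))) atTop
      (𝓝 (ENNReal.ofReal (f x))) := by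
  have hr : Tendsto (fun n : ℕ => (n + 1 : ℝ)⁻¹) atTop (𝓝 0) := by
    simpa using tendsto_one_div_add_atTop_nhds_zero_nat (𝕜 := ℝ)
  rw [ENNReal.tendsto_nhds ENNReal.ofReal_ne_top]
  intro ε hε
  have hcont : Continuous fun u => ENNReal.ofReal (f u) := ENNReal.continuous_ofReal.comp hf
  have h1 : ∀ᶠ u in 𝓝 x, ENNReal.ofReal (f u) ∈
      Set.Icc (ENNReal.ofReal (f x) - ε) (ENNReal.ofReal (f x) + ε) :=
    hcont.continuousAt (ENNReal.Icc_mem_nhds ENNReal.ofReal_ne_top hε.ne')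
  obtain ⟨δ, hδ, hball⟩ := Metric.eventually_nhds_iff_ball.1 h1
  filter_upwards [hr.eventually_lt_const hδ] with n hn
  have hpos : (0 : ℝ) < (n + 1 : ℝ)⁻¹ := by positivity
  set B := Metric.ball x (n + 1 : ℝ)⁻¹
  have : IsProbabilityMeasure (cond F B) := cond_isProbabilityMeasure (hx _ hpos)
  have hae : ∀ᵐ u ∂(cond F B), u ∈ B := by
    filter_upwards [ae_cond_mem Metric.isOpen_ball.measurableSet] with u hu using hu
  have hae' : ∀ᵐ u ∂(cond F B), ENNReal.ofReal (f u) ∈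
      Set.Icc (ENNReal.ofReal (f x) - ε) (ENNReal.ofReal (f x) + ε) := by
    filter_upwards [hae] with u hu
    exact hball u (Metric.ball_subset_ball hn.le hu)
  constructor
  · calc ENNReal.ofReal (f x) - ε = ∫⁻ _, (ENNReal.ofReal (f x) - ε) ∂(cond F B) := by simp
      _ ≤ _ := lintegral_mono_ae (hae'.mono fun u hu => hu.1)
  · calc _ ≤ ∫⁻ _, (ENNReal.ofReal (f x) + ε) ∂(cond F B) :=
          lintegral_mono_ae (hae'.mono fun u hu => hu.2)
      _ = _ := by simp

namespace RegularKernel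

variable {U 𝒴 : Type*} [MeasurableSpace U] [MeasurableSpace 𝒴]
variable {Q : Measure 𝒴} [IsProbabilityMeasure Q] {k : 𝒴 → U → ℝ} {A : ℝ≥0} {c : 𝒴 → ℝ}

lemma mixture_eq_toReal (hk : RegularKernel Q k A) (F : Measure U) [IsFiniteMeasure F] (y : 𝒴) :
    mixture k F y = (∫⁻ u, ENNReal.ofReal (k y u) ∂F).toReal := by
  rw [← hk.ofReal_mixture, ENNReal.toReal_ofReal (hk.mixture_nonneg F y)]

lemma tendsto_mixture_of_lintegral (hk : RegularKernel Q k A) {F : Measure U} [IsFiniteMeasure F]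
    {G : ℕ → Measure U} [∀ n, IsFiniteMeasure (G n)] {y : 𝒴}
    (h : Tendsto (fun n => ∫⁻ u, ENNReal.ofReal (k y u) ∂(G n)) atTop
      (𝓝 (∫⁻ u, ENNReal.ofReal (k y u) ∂F))) :
    Tendsto (fun n => mixture k (G n) y) atTop (𝓝 (mixture k F y)) := by
  simp only [hk.mixture_eq_toReal]
  refine (ENNReal.tendsto_toReal ?_).comp h
  rw [← hk.ofReal_mixture]
  exact ENNReal.ofReal_ne_top

variable [TopologicalSpace U] [TopologicalSpace.MetrizableSpace U] [SecondCountableTopology U]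
  [BorelSpace U]

/-- Each of the finitely many atoms of the image measure is smeared out to `F₀` conditioned on a
small ball around it. The balls have positive mass because the atoms lie in the support, and the
mixtures converge as the balls shrink because the kernel is continuous. -/
lemma le_divergence_map_simpleFunc (hk : RegularKernel Q k A) (hcont : ∀ y, Continuous (k y))
    {F₀ : Measure U} [IsProbabilityMeasure F₀]
    (hc : Integrable (fun y => c y - Real.log (mixture k F₀ y)) Q) {a : ℝ}
    (ha : ∀ (G : Measure U) [IsProbabilityMeasure G] (C : ℝ≥0), G ≤ C • F₀ →
      a ≤ divergence Q c k G)
    (G : Measure U) [IsProbabilityMeasure G] (g : SimpleFunc U U) (hg : ∀ u, g u ∈ F₀.support) :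
    a ≤ divergence Q c k (G.map g) := by
  let := TopologicalSpace.metrizableSpaceMetric U
  have hpos : ∀ x ∈ F₀.support, ∀ r > 0, F₀ (Metric.ball x r) ≠ 0 := fun x hx r hr =>
    ((Measure.mem_support_iff_forall x).1 hx _ (Metric.ball_mem_nhds x hr)).ne'
  set H : ℕ → U → Measure U := fun n u => cond F₀ (Metric.ball (g u) (n + 1 : ℝ)⁻¹) with hH
  have hHm : ∀ n, Measurable (H n) := fun n =>
    (g.map fun x => cond F₀ (Metric.ball x (n + 1 : ℝ)⁻¹)).measurable
  have hHp : ∀ n u, IsProbabilityMeasure (H n u) := fun n u =>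
    cond_isProbabilityMeasure (hpos _ (hg u) _ (by positivity))
  have hGp : ∀ n, IsProbabilityMeasure (G.bind (H n)) := fun n => by
    constructor
    rw [Measure.bind_apply MeasurableSet.univ (hHm n).aemeasurable]
    simp
  have : IsProbabilityMeasure (G.map g) := Measure.isProbabilityMeasure_map g.measurable.aemeasurable
  refine hk.le_divergence_of_tendsto (G := fun n => G.bind (H n))
    (hk.integrable_sub_log F₀ hc _) (fun y => ?_) fun n => ?_
  · refine hk.tendsto_mixture_of_lintegral ?_
    have hmy : Measurable fun u => ENNReal.ofReal (k y u) := (hk.meas_right y).ennreal_ofReal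
    rw [lintegral_map hmy g.measurable]
    simp_rw [Measure.lintegral_bind (hHm _).aemeasurable hmy.aemeasurable]
    obtain ⟨C, hC⟩ := hk.bdd y
    refine tendsto_lintegral_of_dominated_convergence (fun _ => ENNReal.ofReal C)
      (fun n => ?_) (fun n => ae_of_all _ fun u => ?_) (by simp) (ae_of_all _ fun u => ?_)
    · exact (Measure.measurable_lintegral hmy).comp (hHm n)
    · have := hHp n u
      calc ∫⁻ v, ENNReal.ofReal (k y v) ∂(H n u) ≤ ∫⁻ _, ENNReal.ofReal C ∂(H n u) :=
            lintegral_mono fun v => ENNReal.ofReal_le_ofReal (hC v)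
        _ = _ := by simp
    · exact tendsto_lintegral_cond_ball (hpos _ (hg u)) (hcont y)
  -- The sum of the reciprocal ball masses bounds the densities of all the conditioned measures at
  -- once; it is finite because a simple function has finite range.
  · have hfin : ∑ x ∈ g.range, (F₀ (Metric.ball x (n + 1 : ℝ)⁻¹))⁻¹ ≠ ∞ := by
      refine (ENNReal.sum_lt_top.2 fun x hx => ?_).ne
      obtain ⟨u, rfl⟩ := SimpleFunc.mem_range.1 hx
      exact ENNReal.inv_lt_top.2 (pos_iff_ne_zero.2 (hpos _ (hg u) _ (by positivity)))
    refine ha _ (∑ x ∈ g.range, (F₀ (Metric.ball x (n + 1 : ℝ)⁻¹))⁻¹).toNNReal ?_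
    refine Measure.le_iff.2 fun s hs => ?_
    rw [Measure.bind_apply hs (hHm n).aemeasurable]
    calc ∫⁻ u, H n u s ∂G
        ≤ ∫⁻ _, (∑ x ∈ g.range, (F₀ (Metric.ball x (n + 1 : ℝ)⁻¹))⁻¹) * F₀ s ∂G := by
          refine lintegral_mono fun u => ?_
          simp only [hH]
          rw [cond_apply Metric.isOpen_ball.measurableSet]
          gcongr
          · exact Finset.single_le_sum (f := fun x => (F₀ (Metric.ball x (n + 1 : ℝ)⁻¹))⁻¹)
              (fun _ _ => zero_le) (SimpleFunc.mem_range_self g u)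
          · exact Set.inter_subset_right
      _ = _ := by
          simp only [lintegral_const, measure_univ, mul_one, Measure.smul_apply]
          rw [ENNReal.smul_def, ENNReal.coe_toNNReal hfin, smul_eq_mul]

/-- A lower bound for the divergence over the mixing distributions that have a bounded density with
respect to a measure of full support holds on the whole closure of the mixing densities. -/
lemma le_divergence_of_mem_mixingClosure (hk : RegularKernel Q k A)
    (hcont : ∀ y, Continuous (k y)) {μ F₀ : Measure U} [IsProbabilityMeasure F₀]
    (hsupp : ∀ O : Set U, IsOpen O → μ O ≠ 0 → F₀ O ≠ 0)
    (hc : Integrable (fun y => c y - Real.log (mixture k F₀ y)) Q) {a : ℝ}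
    (ha : ∀ (G : Measure U) [IsProbabilityMeasure G] (C : ℝ≥0), G ≤ C • F₀ →
      a ≤ divergence Q c k G) {F : ProbabilityMeasure U} (hF : F ∈ mixingClosure μ) :
    a ≤ divergence Q c k (F : Measure U) := by
  have hdens : ∀ G ∈ mixingDensities μ, a ≤ divergence Q c k (G : Measure U) := by
    rintro G ⟨f, hf, hG⟩
    let := TopologicalSpace.metrizableSpaceMetric U
    -- Full support enters here: the complement of the support is open and `F₀`-null, hence
    -- `μ`-null. Every measure with a `μ`-density thus lives on the support, where simple functions
    -- approximate the identity.
    have hμ : μ F₀.supportᶜ = 0 := by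
      by_contra h
      exact hsupp _ Measure.isOpen_compl_support h Measure.measure_compl_support
    have hGS : ∀ᵐ u ∂(G : Measure U), u ∈ F₀.support := by
      rw [hG]
      exact withDensity_absolutelyContinuous μ f hμ
    obtain ⟨x₀, hx₀⟩ := Measure.nonempty_support (IsProbabilityMeasure.ne_zero F₀)
    set g : ℕ → SimpleFunc U U := SimpleFunc.approxOn id measurable_id F₀.support x₀ hx₀ with hg
    have hgp : ∀ n, IsProbabilityMeasure ((G : Measure U).map (g n)) := fun n =>
      Measure.isProbabilityMeasure_map (g n).measurable.aemeasurable
    refine hk.le_divergence_of_tendsto (G := fun n => (G : Measure U).map (g n))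
      (hk.integrable_sub_log F₀ hc _) (fun y => ?_) fun n =>
        hk.le_divergence_map_simpleFunc hcont hc ha _ _
          (SimpleFunc.approxOn_mem measurable_id hx₀ n)
    refine hk.tendsto_mixture_of_lintegral ?_
    have hmy : Measurable fun u => ENNReal.ofReal (k y u) := (hk.meas_right y).ennreal_ofReal
    simp_rw [lintegral_map hmy (g _).measurable]
    obtain ⟨C, hC⟩ := hk.bdd y
    refine tendsto_lintegral_of_dominated_convergence (fun _ => ENNReal.ofReal C)
      (fun n => hmy.comp (g n).measurable)
      (fun n => ae_of_all _ fun u => ENNReal.ofReal_le_ofReal (hC _)) (by simp) ?_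
    filter_upwards [hGS] with u hu
    have h1 : Tendsto (fun n => g n u) atTop (𝓝 u) :=
      SimpleFunc.tendsto_approxOn measurable_id hx₀ (subset_closure hu)
    exact ((ENNReal.continuous_ofReal.comp (hcont y)).tendsto u).comp h1
  -- The weak topology is metrizable here, so sequences describe the closure; the kernel at a fixed
  -- observation is a bounded continuous test function.
  obtain ⟨G, hG, hlim⟩ := mem_closure_iff_seq_limit.1 hF
  refine hk.le_divergence_of_tendsto (G := fun n => (G n : Measure U))
    (hk.integrable_sub_log F₀ hc _) (fun y => ?_) fun n => hdens _ (hG n)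
  obtain ⟨C, hC⟩ := hk.bdd y
  exact ProbabilityMeasure.tendsto_iff_forall_integral_tendsto.1 hlim
    (BoundedContinuousFunction.ofNormedAddCommGroup (k y) (hcont y) C fun u => by
      rw [Real.norm_eq_abs, abs_of_nonneg (hk.nonneg y u)]; exact hC u)

end RegularKernel

end

/-! ### Deterministic inequalities and sequences -/

section Elementary

/-- From log z ≥ 1 - 1 / z at z = 1 + w h; since h ≥ -1, z ≥ 1 - w, which bounds the denominator of
the quadratic remainder. -/
lemma log_one_add_mul_ge {w h : ℝ} (hw : w ∈ Set.Ioo (0 : ℝ) 1) (hh : -1 ≤ h) :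
    w * h - w ^ 2 / (1 - w) * h ^ 2 ≤ Real.log (1 + w * h) := by
  have h1 : 0 < 1 - w := by linarith [hw.2]
  have hz : 1 - w ≤ 1 + w * h := by nlinarith [hw.1]
  have hz0 : 0 < 1 + w * h := by linarith
  refine le_trans ?_ (Real.one_sub_inv_le_log_of_pos hz0)
  have e : 1 - (1 + w * h)⁻¹ = w * h - w ^ 2 * h ^ 2 / (1 + w * h) := by
    field_simp; ring
  have h2 : w ^ 2 * h ^ 2 / (1 + w * h) ≤ w ^ 2 * h ^ 2 / (1 - w) := by gcongr
  rw [e, div_mul_eq_mul_div]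
  linarith

lemma summable_sq_div_one_sub {w : ℕ → ℝ} (hsq : Summable fun i => w i ^ 2) : Summable fun i => w i ^ 2 / (1 - w i) := by
  refine Summable.of_norm_bounded_eventually_nat (hsq.mul_left 2) ?_
  have h0 := hsq.tendsto_atTop_zero
  filter_upwards [h0.eventually_lt_const (show (0 : ℝ) < 1 / 4 by norm_num)] with i hi
  have h1 : w i ≤ 1 / 2 := by nlinarith
  have h2 : 0 < 1 - w i := by linarith
  rw [Real.norm_eq_abs, abs_of_nonneg (by positivity), div_le_iff₀ h2]
  nlinarith [sq_nonneg (w i)]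

/-- A sequence that decreases up to a convergent and a summable perturbation converges. -/
lemma exists_tendsto_of_almost_decreasing {K w g T b : ℕ → ℝ} {L l : ℝ} (hw : ∀ i, 0 ≤ w i)
    (hL : ∀ n, L ≤ K n) (hT : ∀ i, 1 ≤ T i) (hb : Summable b)
    (hl : Tendsto (fun n => ∑ i ∈ Finset.range n, w i * (g i - T i)) atTop (𝓝 l))
    (hstep : ∀ n, K (n + 1) ≤ K n - w n * (g n - 1) + b n) : ∃ κ, Tendsto K atTop (𝓝 κ) := by
  -- Adding the martingale part and removing the errors leaves steps of at most w (1 - T) ≤ 0.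
  set V : ℕ → ℝ := fun n => K n + (∑ i ∈ Finset.range n, w i * (g i - T i)) -
    ∑ i ∈ Finset.range n, b i with hV
  have hanti : Antitone V := antitone_nat_of_succ_le fun n => by
    simp only [hV, Finset.sum_range_succ]
    have h1 := hstep n
    have h2 : w n * (g n - T n) ≤ w n * (g n - 1) := by
      have := hT n
      exact mul_le_mul_of_nonneg_left (by linarith) (hw n)
    linarith
  have hlb := hb.hasSum.tendsto_sum_nat
  obtain ⟨B, hB⟩ := (hl.sub hlb).bddBelow_range
  have hbdd : BddBelow (Set.range V) := ⟨L + B, by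
    rintro _ ⟨n, rfl⟩
    have h1 := hB ⟨n, rfl⟩
    have h2 := hL n
    simp only [hV] at h1 ⊢
    linarith⟩
  have hVl := tendsto_atTop_ciInf hanti hbdd
  refine ⟨_, (hVl.sub (hl.sub hlb)).congr fun n => ?_⟩
  simp only [hV]; ring

/-- If κ exceeded a, the terms would eventually be at least a fixed multiple of the weights, whose
sum diverges. -/
lemma le_of_sum_mul_sub_bounded {K w : ℕ → ℝ} {κ a B : ℝ} (hw : ∀ i, 0 ≤ w i)
    (hsum : Tendsto (fun n => ∑ i ∈ Finset.range n, w i) atTop atTop)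
    (hK : Tendsto K atTop (𝓝 κ)) (hB : ∀ n, ∑ i ∈ Finset.range n, w i * (K i - a) ≤ B) :
    κ ≤ a := by
  by_contra! h
  set δ := (κ - a) / 2 with hδ
  have hδpos : 0 < δ := by rw [hδ]; linarith
  obtain ⟨N, hN⟩ := eventually_atTop.1 (hK.eventually_const_lt (show a + δ < κ by rw [hδ]; linarith))
  have hge : ∀ n ≥ N, ∑ i ∈ Finset.range N, w i * (K i - a) +
      δ * (∑ i ∈ Finset.range n, w i - ∑ i ∈ Finset.range N, w i) ≤
      ∑ i ∈ Finset.range n, w i * (K i - a) := by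
    intro n hn
    induction n, hn using Nat.le_induction with
    | base => simp
    | succ n hn ih =>
      rw [Finset.sum_range_succ, Finset.sum_range_succ]
      have : w n * δ ≤ w n * (K n - a) :=
        mul_le_mul_of_nonneg_left (by linarith [hN n hn]) (hw n)
      linarith
  have hlim : Tendsto (fun n => ∑ i ∈ Finset.range N, w i * (K i - a) +
      δ * (∑ i ∈ Finset.range n, w i - ∑ i ∈ Finset.range N, w i)) atTop atTop :=
    tendsto_atTop_add_const_left _ _
      ((tendsto_atTop_add_const_right _ _ hsum).const_mul_atTop hδpos)
  obtain ⟨n, hn1, hn2⟩ := ((hlim.eventually_gt_atTop B).and (eventually_ge_atTop N)).exists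
  linarith [hge n hn2, hB n]

end Elementary

/-! ### The effect of one update on the divergence -/

section CrossRatio

variable {U 𝒴 : Type*} [MeasurableSpace U] [MeasurableSpace 𝒴]

/-- The factor by which an update with observation `x'` and full weight changes the mixture density
at `x`. -/
noncomputable def crossRatio (k : 𝒴 → U → ℝ) (F : Measure U) (x x' : 𝒴) : ℝ :=
  (∫ u, k x u * k x' u ∂F) / (mixture k F x * mixture k F x')

lemma ofReal_sub_one_sq_le {p : ℝ} (hp : 0 ≤ p) :
    ENNReal.ofReal ((p - 1) ^ 2) ≤ ENNReal.ofReal (p ^ 2) + 1 := by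
  rw [← ENNReal.ofReal_one, ← ENNReal.ofReal_add (sq_nonneg _) zero_le_one]
  exact ENNReal.ofReal_le_ofReal (by nlinarith)

namespace RegularKernel

variable {Q : Measure 𝒴} [IsProbabilityMeasure Q] {k : 𝒴 → U → ℝ} {A : ℝ≥0} {c : 𝒴 → ℝ}
  {F : Measure U} [IsProbabilityMeasure F]

lemma mixture_dirac (hk : RegularKernel Q k A) (u : U) (x : 𝒴) :
    mixture k (Measure.dirac u) x = k x u :=
  integral_dirac' _ _ (hk.meas_right x).stronglyMeasurable

lemma lintegral_kernel_ratio_sq_le (hk : RegularKernel Q k A) (F : Measure U)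
    [IsProbabilityMeasure F] (u : U) :
    ∫⁻ x, ENNReal.ofReal ((k x u / mixture k F x) ^ 2) ∂Q ≤ A := by
  have := hk.lintegral_ratio_sq_le F (Measure.dirac u)
  simpa only [hk.mixture_dirac] using this

lemma integrable_mul (hk : RegularKernel Q k A) (F : Measure U) [IsFiniteMeasure F] (x x' : 𝒴) :
    Integrable (fun u => k x u * k x' u) F := by
  obtain ⟨C, hC⟩ := hk.bdd x
  refine (hk.integrable F x').bdd_mul (c := C) (hk.meas_right x).aestronglyMeasurable
    (ae_of_all _ fun u => ?_)
  rw [Real.norm_eq_abs, abs_of_nonneg (hk.nonneg x u)]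
  exact hC u

lemma crossRatio_nonneg (hk : RegularKernel Q k A) (F : Measure U) (x x' : 𝒴) :
    0 ≤ crossRatio k F x x' :=
  div_nonneg (integral_nonneg fun u => mul_nonneg (hk.nonneg x u) (hk.nonneg x' u))
    (mul_nonneg (hk.mixture_nonneg F x) (hk.mixture_nonneg F x'))

lemma measurable_kernel_ratio (hk : RegularKernel Q k A) (F : Measure U) [SFinite F] :
    Measurable fun z : 𝒴 × U => k z.1 z.2 / mixture k F z.1 :=
  hk.meas.div ((hk.measurable_mixture F).comp measurable_fst)

/-- For fixed u the integrand is a product of a function of x and a function of x', so Tonelli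
separates the two observations. -/
lemma ofReal_crossRatio (hk : RegularKernel Q k A) (x x' : 𝒴) :
    ENNReal.ofReal (crossRatio k F x x') =
      ∫⁻ u, ENNReal.ofReal (k x u / mixture k F x) * ENNReal.ofReal (k x' u / mixture k F x') ∂F := by
  have e : crossRatio k F x x' = ∫ u, (k x u / mixture k F x) * (k x' u / mixture k F x') ∂F := by
    rw [crossRatio, ← integral_div]
    congr 1; funext u
    rw [div_mul_div_comm]
  have hn : ∀ x u, 0 ≤ k x u / mixture k F x := fun x u =>
    div_nonneg (hk.nonneg x u) (hk.mixture_nonneg F x)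
  rw [e, ofReal_integral_eq_lintegral_ofReal]
  · exact lintegral_congr fun u => ENNReal.ofReal_mul (hn x u)
  · refine ((hk.integrable_mul F x x').div_const (mixture k F x * mixture k F x')).congr
      (ae_of_all _ fun u => ?_)
    simp only [div_mul_div_comm]
  · exact ae_of_all _ fun u => mul_nonneg (hn x u) (hn x' u)

lemma measurable_crossRatio (hk : RegularKernel Q k A) (F : Measure U) [SFinite F] :
    Measurable (Function.uncurry (crossRatio k F)) := by
  refine Measurable.div ?_ (((hk.measurable_mixture F).comp measurable_fst).mul
    ((hk.measurable_mixture F).comp measurable_snd))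
  have : Measurable fun z : (𝒴 × 𝒴) × U => k z.1.1 z.2 * k z.1.2 z.2 :=
    (hk.meas.comp ((measurable_fst.comp measurable_fst).prodMk measurable_snd)).mul
      (hk.meas.comp ((measurable_snd.comp measurable_fst).prodMk measurable_snd))
  exact this.stronglyMeasurable.integral_prod_right.measurable

/-- Jensen moves the square inside the integral over u. For fixed u the integrals over x and x' then
separate, and each is at most `A`. -/
lemma lintegral_crossRatio_sq_le (hk : RegularKernel Q k A) :
    ∫⁻ x', ∫⁻ x, ENNReal.ofReal (crossRatio k F x x' ^ 2) ∂Q ∂Q ≤ (A ^ 2 : ℝ≥0) := by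
  set ρ : 𝒴 → U → ℝ≥0∞ := fun x u => ENNReal.ofReal (k x u / mixture k F x) ^ 2 with hρ
  have hρm : Measurable (Function.uncurry ρ) :=
    (hk.measurable_kernel_ratio F).ennreal_ofReal.pow_const 2
  have hρA : ∀ u, ∫⁻ x, ρ x u ∂Q ≤ A := fun u => by
    refine le_trans (lintegral_mono fun x => ?_) (hk.lintegral_kernel_ratio_sq_le F u)
    simp only [hρ]
    rw [ENNReal.ofReal_pow (div_nonneg (hk.nonneg x u) (hk.mixture_nonneg F x))]
  have hpt : ∀ x x', ENNReal.ofReal (crossRatio k F x x' ^ 2) ≤ ∫⁻ u, ρ x u * ρ x' u ∂F := by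
    intro x x'
    rw [ENNReal.ofReal_pow (hk.crossRatio_nonneg F x x'), hk.ofReal_crossRatio]
    have hm : ∀ x, Measurable fun u => ENNReal.ofReal (k x u / mixture k F x) := fun x =>
      ((hk.meas_right x).div_const _).ennreal_ofReal
    calc _ ≤ ∫⁻ u, (ENNReal.ofReal (k x u / mixture k F x) *
          ENNReal.ofReal (k x' u / mixture k F x')) ^ 2 ∂F := sq_lintegral_le ((hm x).mul (hm x'))
      _ = _ := by simp only [hρ, mul_pow]
  have hmx : ∀ u, Measurable fun x => ρ x u := fun u => hρm.comp measurable_prodMk_right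
  have hmu : ∀ x, Measurable fun u => ρ x u := fun x => hρm.comp measurable_prodMk_left
  have hm3 : ∀ x', AEMeasurable (Function.uncurry fun x u => ρ x u * ρ x' u) (Q.prod F) :=
    fun x' => (hρm.mul ((hmu x').comp measurable_snd)).aemeasurable
  calc ∫⁻ x', ∫⁻ x, ENNReal.ofReal (crossRatio k F x x' ^ 2) ∂Q ∂Q
      ≤ ∫⁻ x', ∫⁻ x, ∫⁻ u, ρ x u * ρ x' u ∂F ∂Q ∂Q :=
        lintegral_mono fun x' => lintegral_mono fun x => hpt x x'
    _ = ∫⁻ x', ∫⁻ u, ∫⁻ x, ρ x u * ρ x' u ∂Q ∂F ∂Q := by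
        refine lintegral_congr fun x' => lintegral_lintegral_swap (hm3 x')
    _ = ∫⁻ x', ∫⁻ u, (∫⁻ x, ρ x u ∂Q) * ρ x' u ∂F ∂Q := by
        refine lintegral_congr fun x' => lintegral_congr fun u => ?_
        rw [lintegral_mul_const _ (hmx u)]
    _ ≤ ∫⁻ x', ∫⁻ u, A * ρ x' u ∂F ∂Q := by
        gcongr with x' u; exact hρA u
    _ = ∫⁻ u, ∫⁻ x', A * ρ x' u ∂Q ∂F :=
        lintegral_lintegral_swap (hρm.const_mul _).aemeasurable
    _ ≤ ∫⁻ _, A * A ∂F := by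
        refine lintegral_mono fun u => ?_
        rw [lintegral_const_mul _ (hmx u)]
        gcongr; exact hρA u
    _ = _ := by simp [sq]

lemma integrable_crossRatio (hk : RegularKernel Q k A) (F : Measure U) [IsProbabilityMeasure F] :
    Integrable (fun z : 𝒴 × 𝒴 => crossRatio k F z.2 z.1) (Q.prod Q) := by
  have hm : Measurable fun z : 𝒴 × 𝒴 => crossRatio k F z.2 z.1 :=
    (hk.measurable_crossRatio F).comp measurable_swap
  refine (memLp_two_of_lintegral_sq_le hm.aestronglyMeasurable
    (ne_top_of_le_ne_top (ENNReal.coe_ne_top (r := A ^ 2)) ?_)).integrable one_le_two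
  · rw [lintegral_prod _ (hm.pow_const 2).ennreal_ofReal.aemeasurable]
    exact hk.lintegral_crossRatio_sq_le

/-- With h(u) = ∫ k(x, u) / m_F(x) dQ(x), the double integral is ∫ h² dF, which is at least (∫ h
dF)² = 1. This makes the mean gain of an update nonnegative. -/
lemma one_le_integral_crossRatio (hk : RegularKernel Q k A) (hpos : ∀ x, 0 < mixture k F x) :
    1 ≤ ∫ x', ∫ x, crossRatio k F x x' ∂Q ∂Q := by
  set ρ : 𝒴 → U → ℝ≥0∞ := fun x u => ENNReal.ofReal (k x u / mixture k F x) with hρ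
  have hρm : Measurable (Function.uncurry ρ) := (hk.measurable_kernel_ratio F).ennreal_ofReal
  have hmx : ∀ u, Measurable fun x => ρ x u := fun u => hρm.comp measurable_prodMk_right
  have hmu : ∀ x, Measurable fun u => ρ x u := fun x => hρm.comp measurable_prodMk_left
  have hone : ∀ x, ∫⁻ u, ρ x u ∂F = 1 := by
    intro x
    have h : ∀ u, ρ x u = ENNReal.ofReal (k x u) / ENNReal.ofReal (mixture k F x) :=
      fun u => ENNReal.ofReal_div_of_pos (hpos x)
    simp only [h, div_eq_mul_inv]
    rw [lintegral_mul_const _ (hk.meas_right x).ennreal_ofReal, ← hk.ofReal_mixture]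
    exact ENNReal.mul_inv_cancel (by simpa using hpos x) ENNReal.ofReal_ne_top
  have hm3 : ∀ x', AEMeasurable (Function.uncurry fun x u => ρ x u * ρ x' u) (Q.prod F) :=
    fun x' => (hρm.mul ((hmu x').comp measurable_snd)).aemeasurable
  have key : 1 ≤ ∫⁻ x', ∫⁻ x, ENNReal.ofReal (crossRatio k F x x') ∂Q ∂Q := by
    calc (1 : ℝ≥0∞) = (∫⁻ x, ∫⁻ u, ρ x u ∂F ∂Q) ^ 2 := by simp [hone]
      _ = (∫⁻ u, ∫⁻ x, ρ x u ∂Q ∂F) ^ 2 := by rw [lintegral_lintegral_swap hρm.aemeasurable]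
      _ ≤ ∫⁻ u, (∫⁻ x, ρ x u ∂Q) ^ 2 ∂F :=
          sq_lintegral_le (hρm.comp measurable_swap).lintegral_prod_right'
      _ = ∫⁻ u, ∫⁻ x', (∫⁻ x, ρ x u ∂Q) * ρ x' u ∂Q ∂F := by
          refine lintegral_congr fun u => ?_
          rw [lintegral_const_mul _ (hmx u), sq]
      _ = ∫⁻ x', ∫⁻ u, (∫⁻ x, ρ x u ∂Q) * ρ x' u ∂F ∂Q := by
          refine lintegral_lintegral_swap ?_
          exact (((hρm.comp measurable_swap).lintegral_prod_right' (ν := Q)).comp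
            measurable_fst).mul (hρm.comp measurable_swap) |>.aemeasurable
      _ = ∫⁻ x', ∫⁻ u, ∫⁻ x, ρ x u * ρ x' u ∂Q ∂F ∂Q := by
          refine lintegral_congr fun x' => lintegral_congr fun u => ?_
          rw [lintegral_mul_const _ (hmx u)]
      _ = ∫⁻ x', ∫⁻ x, ∫⁻ u, ρ x u * ρ x' u ∂F ∂Q ∂Q := by
          refine lintegral_congr fun x' => (lintegral_lintegral_swap (hm3 x')).symm
      _ = _ := by simp only [hρ, hk.ofReal_crossRatio]
  have hint := hk.integrable_crossRatio F
  rw [← integral_prod _ hint]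
  have hm : Measurable fun z : 𝒴 × 𝒴 => crossRatio k F z.2 z.1 :=
    (hk.measurable_crossRatio F).comp measurable_swap
  have h2 : ENNReal.ofReal (∫ z, crossRatio k F z.2 z.1 ∂(Q.prod Q)) =
      ∫⁻ x', ∫⁻ x, ENNReal.ofReal (crossRatio k F x x') ∂Q ∂Q := by
    rw [ofReal_integral_eq_lintegral_ofReal hint (ae_of_all _ fun z => hk.crossRatio_nonneg F _ _),
      lintegral_prod _ hm.ennreal_ofReal.aemeasurable]
  rw [← h2] at key
  exact ENNReal.one_le_ofReal.1 key

lemma lintegral_integral_crossRatio_sq_le (hk : RegularKernel Q k A) (F : Measure U)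
    [IsProbabilityMeasure F] :
    ∫⁻ x', ENNReal.ofReal ((∫ x, crossRatio k F x x' ∂Q) ^ 2) ∂Q ≤ (A ^ 2 : ℝ≥0) := by
  refine le_trans (lintegral_mono fun x' => ?_) (hk.lintegral_crossRatio_sq_le (F := F))
  have hm : Measurable fun x => crossRatio k F x x' :=
    (hk.measurable_crossRatio F).comp measurable_prodMk_right
  have h0 : 0 ≤ ∫ x, crossRatio k F x x' ∂Q := integral_nonneg fun x => hk.crossRatio_nonneg F _ _
  rw [ENNReal.ofReal_pow h0]
  calc ENNReal.ofReal (∫ x, crossRatio k F x x' ∂Q) ^ 2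
      ≤ (∫⁻ x, ENNReal.ofReal (crossRatio k F x x') ∂Q) ^ 2 := by
        gcongr
        rw [integral_eq_lintegral_of_nonneg_ae (ae_of_all _ fun x => hk.crossRatio_nonneg F _ _)
          hm.aestronglyMeasurable]
        exact ENNReal.ofReal_toReal_le
    _ ≤ ∫⁻ x, ENNReal.ofReal (crossRatio k F x x') ^ 2 ∂Q := sq_lintegral_le hm.ennreal_ofReal
    _ = _ := by simp only [ENNReal.ofReal_pow (hk.crossRatio_nonneg F _ _)]

lemma lintegral_crossRatio_sub_one_sq_le (hk : RegularKernel Q k A) (F : Measure U)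
    [IsProbabilityMeasure F] :
    ∫⁻ x', ∫⁻ x, ENNReal.ofReal ((crossRatio k F x x' - 1) ^ 2) ∂Q ∂Q ≤ (A ^ 2 + 1 : ℝ≥0) := by
  calc ∫⁻ x', ∫⁻ x, ENNReal.ofReal ((crossRatio k F x x' - 1) ^ 2) ∂Q ∂Q
      ≤ ∫⁻ x', ∫⁻ x, (ENNReal.ofReal (crossRatio k F x x' ^ 2) + 1) ∂Q ∂Q :=
        lintegral_mono fun x' => lintegral_mono fun x =>
          ofReal_sub_one_sq_le (hk.crossRatio_nonneg F _ _)
    _ = ∫⁻ x', ∫⁻ x, ENNReal.ofReal (crossRatio k F x x' ^ 2) ∂Q ∂Q + 1 := by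
        simp_rw [lintegral_add_right _ measurable_const]
        simp
    _ ≤ _ := by
        push_cast
        gcongr
        exact_mod_cast hk.lintegral_crossRatio_sq_le

/-- The change of the divergence in one update with observation `x'` and weight `w`. -/
lemma divergence_update_le (hk : RegularKernel Q k A) {F' : Measure U} [IsProbabilityMeasure F']
    (hc : Integrable (fun y => c y - Real.log (mixture k F y)) Q) {x' : 𝒴} {w : ℝ}
    (hw : w ∈ Set.Ioo (0 : ℝ) 1)
    (hF' : ∀ x, mixture k F' x = mixture k F x * (1 + w * (crossRatio k F x x' - 1)))
    (hfin : ∫⁻ x, ENNReal.ofReal ((crossRatio k F x x' - 1) ^ 2) ∂Q ≠ ∞) :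
    divergence Q c k F' ≤ divergence Q c k F - w * (∫ x, crossRatio k F x x' ∂Q - 1) +
      w ^ 2 / (1 - w) * (∫⁻ x, ENNReal.ofReal ((crossRatio k F x x' - 1) ^ 2) ∂Q).toReal := by
  have hm : Measurable fun x => crossRatio k F x x' :=
    (hk.measurable_crossRatio F).comp measurable_prodMk_right
  have hL : MemLp (fun x => crossRatio k F x x' - 1) 2 Q :=
    memLp_two_of_lintegral_sq_le (hm.sub_const 1).aestronglyMeasurable hfin
  have h1 := hL.integrable one_le_two
  have h2 := hL.integrable_sq
  have h3 : Integrable (fun x => crossRatio k F x x') Q := by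
    have := h1.add (integrable_const 1)
    refine this.congr (ae_of_all _ fun x => ?_)
    simp
  have e2 : (∫⁻ x, ENNReal.ofReal ((crossRatio k F x x' - 1) ^ 2) ∂Q).toReal =
      ∫ x, (crossRatio k F x x' - 1) ^ 2 ∂Q := by
    rw [integral_eq_lintegral_of_nonneg_ae (ae_of_all _ fun x => sq_nonneg _)
      h2.aestronglyMeasurable]
  have e1 : ∫ x, crossRatio k F x x' ∂Q - 1 = ∫ x, (crossRatio k F x x' - 1) ∂Q := by
    rw [integral_sub h3 (integrable_const _)]; simp
  rw [hk.divergence_eq_add F' F hc, e1, e2]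
  have h4 : ∫ y, Real.log (mixture k F y / mixture k F' y) ∂Q ≤
      ∫ x, (w ^ 2 / (1 - w) * (crossRatio k F x x' - 1) ^ 2 - w * (crossRatio k F x x' - 1)) ∂Q := by
    refine integral_mono_ae (hk.integrable_log_ratio F' F)
      ((h2.const_mul _).sub (h1.const_mul _)) ?_
    filter_upwards [hk.mixture_pos F, hk.mixture_pos F'] with x hx hx'
    have h5 := log_one_add_mul_ge hw (h := crossRatio k F x x' - 1)
      (by linarith [hk.crossRatio_nonneg F x x'])
    have h6 : mixture k F' x / mixture k F x = 1 + w * (crossRatio k F x x' - 1) := by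
      rw [hF' x, mul_div_cancel_left₀ _ hx.ne']
    have h7 : Real.log (mixture k F x / mixture k F' x) =
        -Real.log (1 + w * (crossRatio k F x x' - 1)) := by
      rw [← h6, ← Real.log_inv, inv_div]
    rw [h7]
    linarith
  rw [integral_sub (h2.const_mul _) (h1.const_mul _), integral_const_mul, integral_const_mul] at h4
  linarith

end RegularKernel

end CrossRatio

/-! ### Invariants of the recursion -/

section

variable {U 𝒴 : Type*} [MeasurableSpace U] [MeasurableSpace 𝒴]

/-- Predictive recursion with a regular kernel that is positive at all observations. -/
structure RegularRecursion (μ : Measure U) (Q : Measure 𝒴) (k : 𝒴 → U → ℝ) (A : ℝ≥0) (w : ℕ → ℝ)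
    (f₀ : U → ℝ) : Prop where
  kernel : RegularKernel Q k A
  kernel_pos : ∀ y, ∀ᵐ u ∂μ, 0 < k y u
  weight : ∀ i, w i ∈ Set.Ioo (0 : ℝ) 1
  meas : Measurable f₀
  nonneg : ∀ u, 0 ≤ f₀ u
  dens : ∫⁻ u, ENNReal.ofReal (f₀ u) ∂μ = 1

/-- The mixing distribution after `i` steps of predictive recursion. -/
noncomputable def prMeasure (μ : Measure U) (k : 𝒴 → U → ℝ) (w : ℕ → ℝ) (f₀ : U → ℝ) (y : ℕ → 𝒴)
    (i : ℕ) : Measure U :=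
  μ.withDensity fun u => ENNReal.ofReal (prDensity μ k w f₀ y i u)

/-- The ratio of the mixing densities after and before an update with observation `x`. -/
noncomputable def updateFactor (k : 𝒴 → U → ℝ) (F : Measure U) (w : ℝ) (x : 𝒴) (u : U) : ℝ :=
  1 + w * (k x u / mixture k F x - 1)

lemma integral_withDensity_ofReal {μ : Measure U} {f : U → ℝ} (hf : Measurable f)
    (h0 : ∀ u, 0 ≤ f u) (φ : U → ℝ) :
    ∫ u, φ u ∂(μ.withDensity fun u => ENNReal.ofReal (f u)) = ∫ u, φ u * f u ∂μ := by
  rw [integral_withDensity_eq_integral_toReal_smul hf.ennreal_ofReal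
    (ae_of_all _ fun u => ENNReal.ofReal_lt_top)]
  congr 1; funext u
  rw [ENNReal.toReal_ofReal (h0 u), smul_eq_mul, mul_comm]

variable {μ : Measure U} {k : 𝒴 → U → ℝ} {w : ℕ → ℝ} {f₀ : U → ℝ}

lemma measurable_prDensity [SFinite μ] (hk : Measurable (Function.uncurry k)) (hf : Measurable f₀)
    (i : ℕ) : Measurable fun z : (ℕ → 𝒴) × U => prDensity μ k w f₀ z.1 i z.2 := by
  induction i with
  | zero => exact hf.comp measurable_snd
  | succ i ih =>
    simp only [prDensity]
    have hz : Measurable fun z : (ℕ → 𝒴) × U => (z.1 i, z.2) :=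
      ((measurable_pi_apply i).comp measurable_fst).prodMk measurable_snd
    have hyi : Measurable fun z : (ℕ → 𝒴) × U => k (z.1 i) z.2 := hk.comp hz
    have hint : Measurable fun y : ℕ → 𝒴 => ∫ u', k (y i) u' * prDensity μ k w f₀ y i u' ∂μ :=
      (hyi.mul ih).stronglyMeasurable.integral_prod_right.measurable
    exact (ih.const_mul _).add (((hyi.mul ih).div (hint.comp measurable_fst)).const_mul _)

lemma predictable_prDensity : Predictable fun i (y : ℕ → 𝒴) => prDensity μ k w f₀ y i := by
  intro i
  induction i with
  | zero => intro y y' _; rfl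
  | succ i ih =>
    intro y y' h
    have h1 := ih y y' fun j hj => h j (hj.trans i.lt_succ_self)
    simp only at h1
    funext u
    simp only [prDensity, h1, h i i.lt_succ_self]

lemma predictable_prMeasure : Predictable fun i (y : ℕ → 𝒴) => prMeasure μ k w f₀ y i := by
  intro i y y' h
  have := predictable_prDensity (μ := μ) (k := k) (w := w) (f₀ := f₀) i y y' h
  simp only at this
  simp only [prMeasure, this]

namespace RegularRecursion

variable {Q : Measure 𝒴} [IsProbabilityMeasure Q] {A : ℝ≥0} {c : 𝒴 → ℝ}

lemma ae_pos (h : RegularRecursion μ Q k A w f₀) {F : Measure U} (hF : F ≪ μ) (x : 𝒴) :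
    ∀ᵐ u ∂F, 0 < k x u := hF (h.kernel_pos x)

lemma updateFactor_ge (h : RegularRecursion μ Q k A w f₀) (F : Measure U) (i : ℕ) (x : 𝒴) (u : U) :
    1 - w i ≤ updateFactor k F (w i) x u := by
  have h1 : 0 ≤ k x u / mixture k F x := div_nonneg (h.kernel.nonneg x u) (h.kernel.mixture_nonneg F x)
  have := (h.weight i).1
  simp only [updateFactor]
  nlinarith

lemma updateFactor_pos (h : RegularRecursion μ Q k A w f₀) (F : Measure U) (i : ℕ) (x : 𝒴) (u : U) :
    0 < updateFactor k F (w i) x u :=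
  lt_of_lt_of_le (by linarith [(h.weight i).2]) (h.updateFactor_ge F i x u)

lemma measurable_updateFactor (h : RegularRecursion μ Q k A w f₀) (F : Measure U) (a : ℝ) (x : 𝒴) :
    Measurable (updateFactor k F a x) :=
  ((((h.kernel.meas_right x).div_const _).sub_const 1).const_mul a).const_add 1

section Invariants

variable [SFinite μ]

lemma measurable_prDensity_right (h : RegularRecursion μ Q k A w f₀) (y : ℕ → 𝒴) (i : ℕ) :
    Measurable (prDensity μ k w f₀ y i) :=
  (measurable_prDensity h.kernel.meas h.meas i).comp measurable_prodMk_left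

lemma lintegral_prMeasure (h : RegularRecursion μ Q k A w f₀) (y : ℕ → 𝒴) (i : ℕ)
    {φ : U → ℝ≥0∞} (hφ : Measurable φ) :
    ∫⁻ u, φ u ∂(prMeasure μ k w f₀ y i) =
      ∫⁻ u, ENNReal.ofReal (prDensity μ k w f₀ y i u) * φ u ∂μ :=
  lintegral_withDensity_eq_lintegral_mul _ (h.measurable_prDensity_right y i).ennreal_ofReal hφ

lemma prDensity_succ_of_nonneg (h : RegularRecursion μ Q k A w f₀) (y : ℕ → 𝒴) (i : ℕ)
    (h0 : ∀ u, 0 ≤ prDensity μ k w f₀ y i u) (u : U) :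
    prDensity μ k w f₀ y (i + 1) u = prDensity μ k w f₀ y i u *
      updateFactor k (prMeasure μ k w f₀ y i) (w i) (y i) u := by
  have e : mixture k (prMeasure μ k w f₀ y i) (y i) =
      ∫ u', k (y i) u' * prDensity μ k w f₀ y i u' ∂μ :=
    integral_withDensity_ofReal (h.measurable_prDensity_right y i) h0 _
  simp only [prDensity, updateFactor, e]
  ring

lemma prMeasure_univ (y : ℕ → 𝒴) (i : ℕ) : prMeasure μ k w f₀ y i Set.univ =
    ∫⁻ u, ENNReal.ofReal (prDensity μ k w f₀ y i u) ∂μ := by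
  rw [prMeasure, withDensity_apply _ MeasurableSet.univ, setLIntegral_univ]

/-- The two claims need a joint induction: nonnegativity identifies the normalizing integral with a
mixture, and total mass one makes that mixture positive, so that the next density has mass one. -/
lemma nonneg_and_isProbabilityMeasure (h : RegularRecursion μ Q k A w f₀) (y : ℕ → 𝒴) (i : ℕ) :
    (∀ u, 0 ≤ prDensity μ k w f₀ y i u) ∧ IsProbabilityMeasure (prMeasure μ k w f₀ y i) := by
  induction i with
  | zero => exact ⟨h.nonneg, ⟨(prMeasure_univ y 0).trans h.dens⟩⟩
  | succ i ih =>
    obtain ⟨h0, hp⟩ := ih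
    have hrec := h.prDensity_succ_of_nonneg y i h0
    have hpos : 0 < mixture k (prMeasure μ k w f₀ y i) (y i) :=
      h.kernel.mixture_pos_of_ae _ (h.ae_pos (withDensity_absolutelyContinuous _ _) _)
    refine ⟨fun u => ?_, ⟨?_⟩⟩
    · rw [hrec u]
      exact mul_nonneg (h0 u) (h.updateFactor_pos _ i _ u).le
    · have hm := (h.measurable_updateFactor (prMeasure μ k w f₀ y i) (w i) (y i)).ennreal_ofReal
      have e2 : prMeasure μ k w f₀ y (i + 1) Set.univ =
          ∫⁻ u, ENNReal.ofReal (updateFactor k (prMeasure μ k w f₀ y i) (w i) (y i) u)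
            ∂(prMeasure μ k w f₀ y i) := by
        rw [prMeasure_univ, h.lintegral_prMeasure y i hm]
        refine lintegral_congr fun u => ?_
        rw [hrec u, ENNReal.ofReal_mul (h0 u)]
      have hi := h.kernel.integrable (prMeasure μ k w f₀ y i) (y i)
      have hi2 : Integrable (fun u => k (y i) u / mixture k (prMeasure μ k w f₀ y i) (y i) - 1)
          (prMeasure μ k w f₀ y i) := (hi.div_const _).sub (integrable_const _)
      have hi3 : Integrable (updateFactor k (prMeasure μ k w f₀ y i) (w i) (y i))
          (prMeasure μ k w f₀ y i) := (integrable_const (1 : ℝ)).add (hi2.const_mul (w i))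
      have e3 : ∫ u, updateFactor k (prMeasure μ k w f₀ y i) (w i) (y i) u
          ∂(prMeasure μ k w f₀ y i) = 1 := by
        simp only [updateFactor]
        rw [integral_add (integrable_const _) (hi2.const_mul _), integral_const_mul,
          integral_sub (hi.div_const _) (integrable_const _), integral_div]
        have : ∫ u, k (y i) u ∂(prMeasure μ k w f₀ y i) =
          mixture k (prMeasure μ k w f₀ y i) (y i) := rfl
        rw [this, div_self hpos.ne']
        simp
      rw [e2, ← ofReal_integral_eq_lintegral_ofReal hi3
        (ae_of_all _ fun u => (h.updateFactor_pos _ i _ u).le), e3, ENNReal.ofReal_one]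

lemma prDensity_nonneg (h : RegularRecursion μ Q k A w f₀) (y : ℕ → 𝒴) (i : ℕ) (u : U) :
    0 ≤ prDensity μ k w f₀ y i u := (h.nonneg_and_isProbabilityMeasure y i).1 u

lemma isProbabilityMeasure (h : RegularRecursion μ Q k A w f₀) (y : ℕ → 𝒴) (i : ℕ) :
    IsProbabilityMeasure (prMeasure μ k w f₀ y i) := (h.nonneg_and_isProbabilityMeasure y i).2

lemma prDensity_succ (h : RegularRecursion μ Q k A w f₀) (y : ℕ → 𝒴) (i : ℕ) (u : U) :
    prDensity μ k w f₀ y (i + 1) u = prDensity μ k w f₀ y i u *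
      updateFactor k (prMeasure μ k w f₀ y i) (w i) (y i) u := h.prDensity_succ_of_nonneg y i (h.prDensity_nonneg y i) u

lemma integral_prMeasure (h : RegularRecursion μ Q k A w f₀) (y : ℕ → 𝒴) (i : ℕ) (φ : U → ℝ) :
    ∫ u, φ u ∂(prMeasure μ k w f₀ y i) = ∫ u, φ u * prDensity μ k w f₀ y i u ∂μ :=
  integral_withDensity_ofReal (h.measurable_prDensity_right y i) (h.prDensity_nonneg y i) φ

lemma prMixture_eq (h : RegularRecursion μ Q k A w f₀) (y : ℕ → 𝒴) (i : ℕ) (x : 𝒴) :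
    prMixture μ k w f₀ y i x = mixture k (prMeasure μ k w f₀ y i) x :=
  (h.integral_prMeasure y i _).symm

lemma mixture_pos_of_absolutelyContinuous (h : RegularRecursion μ Q k A w f₀) {F : Measure U}
    [IsProbabilityMeasure F] (hF : F ≪ μ) (x : 𝒴) : 0 < mixture k F x :=
  h.kernel.mixture_pos_of_ae F (h.ae_pos hF x)

lemma mixture_prMeasure_pos (h : RegularRecursion μ Q k A w f₀) (y : ℕ → 𝒴) (i : ℕ) (x : 𝒴) :
    0 < mixture k (prMeasure μ k w f₀ y i) x := by
  have := h.isProbabilityMeasure y i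
  exact h.mixture_pos_of_absolutelyContinuous (F := prMeasure μ k w f₀ y i)
    (withDensity_absolutelyContinuous _ _) x

lemma mixture_prMeasure_succ (h : RegularRecursion μ Q k A w f₀) (y : ℕ → 𝒴) (i : ℕ) (x : 𝒴) :
    mixture k (prMeasure μ k w f₀ y (i + 1)) x = mixture k (prMeasure μ k w f₀ y i) x *
      (1 + w i * (crossRatio k (prMeasure μ k w f₀ y i) x (y i) - 1)) := by
  have := h.isProbabilityMeasure y i
  have hx := h.mixture_prMeasure_pos y i x
  have hy := h.mixture_prMeasure_pos y i (y i)
  set F := prMeasure μ k w f₀ y i with hF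
  have e : mixture k (prMeasure μ k w f₀ y (i + 1)) x =
      ∫ u, k x u * updateFactor k F (w i) (y i) u ∂F := by
    rw [mixture, h.integral_prMeasure, hF, h.integral_prMeasure]
    congr 1; funext u
    rw [h.prDensity_succ]; ring
  have e2 : (fun u => k x u * updateFactor k F (w i) (y i) u) = fun u =>
      (1 - w i) * k x u + w i / mixture k F (y i) * (k x u * k (y i) u) := by
    funext u; simp only [updateFactor]; ring
  rw [e, e2, integral_add ((h.kernel.integrable F x).const_mul _)
    ((h.kernel.integrable_mul F x (y i)).const_mul _), integral_const_mul, integral_const_mul,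
    crossRatio]
  have e3 : ∫ u, k x u ∂F = mixture k F x := rfl
  rw [e3]
  field_simp
  ring

lemma prMeasure_mem_mixingDensities (h : RegularRecursion μ Q k A w f₀) (y : ℕ → 𝒴) (i : ℕ) :
    (⟨prMeasure μ k w f₀ y i, h.isProbabilityMeasure y i⟩ : ProbabilityMeasure U) ∈
      mixingDensities μ :=
  ⟨_, (h.measurable_prDensity_right y i).ennreal_ofReal, rfl⟩

lemma measurable_mixture_prMeasure (h : RegularRecursion μ Q k A w f₀) (i : ℕ) :
    Measurable fun z : (ℕ → 𝒴) × 𝒴 => mixture k (prMeasure μ k w f₀ z.1 i) z.2 := by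
  simp_rw [← h.prMixture_eq]
  have : Measurable fun z : ((ℕ → 𝒴) × 𝒴) × U => k z.1.2 z.2 * prDensity μ k w f₀ z.1.1 i z.2 :=
    (h.kernel.meas.comp ((measurable_snd.comp measurable_fst).prodMk measurable_snd)).mul
      ((measurable_prDensity h.kernel.meas h.meas i).comp
        ((measurable_fst.comp measurable_fst).prodMk measurable_snd))
  exact this.stronglyMeasurable.integral_prod_right.measurable

lemma measurable_crossRatio_prMeasure (h : RegularRecursion μ Q k A w f₀) (i : ℕ) :
    Measurable fun z : ((ℕ → 𝒴) × 𝒴) × 𝒴 =>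
      crossRatio k (prMeasure μ k w f₀ z.1.1 i) z.2 z.1.2 := by
  simp only [crossRatio]
  refine Measurable.div ?_ (Measurable.mul ?_ ?_)
  · simp_rw [h.integral_prMeasure]
    have : Measurable fun z : (((ℕ → 𝒴) × 𝒴) × 𝒴) × U =>
        k z.1.2 z.2 * k z.1.1.2 z.2 * prDensity μ k w f₀ z.1.1.1 i z.2 :=
      ((h.kernel.meas.comp ((measurable_snd.comp measurable_fst).prodMk measurable_snd)).mul
        (h.kernel.meas.comp ((measurable_snd.comp
          (measurable_fst.comp measurable_fst)).prodMk measurable_snd))).mul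
        ((measurable_prDensity h.kernel.meas h.meas i).comp
          ((measurable_fst.comp (measurable_fst.comp measurable_fst)).prodMk measurable_snd))
    exact this.stronglyMeasurable.integral_prod_right.measurable
  · exact (h.measurable_mixture_prMeasure i).comp
      ((measurable_fst.comp measurable_fst).prodMk measurable_snd)
  · exact (h.measurable_mixture_prMeasure i).comp measurable_fst

/-- The log-likelihood of the updates under a mixing distribution with bounded density is bounded:
the sum of the linear terms is at most a constant plus the weighted sum of the quadratic terms. -/
lemma sum_weight_mul_ratio_le (h : RegularRecursion μ Q k A w f₀) (y : ℕ → 𝒴) {G : Measure U}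
    [IsProbabilityMeasure G] {C : ℝ≥0} (hG : G ≤ C • prMeasure μ k w f₀ y 0) (n : ℕ) :
    ∑ i ∈ Finset.range n, w i *
        (mixture k G (y i) / mixture k (prMeasure μ k w f₀ y i) (y i) - 1) ≤
      C - 1 + ∑ i ∈ Finset.range n, w i ^ 2 / (1 - w i) *
        (∫⁻ u, ENNReal.ofReal ((k (y i) u / mixture k (prMeasure μ k w f₀ y i) (y i) - 1) ^ 2)
          ∂G).toReal := by
  set r : ℕ → U → ℝ := fun i => updateFactor k (prMeasure μ k w f₀ y i) (w i) (y i) with hr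
  set d : ℕ → U → ℝ := fun i u => k (y i) u / mixture k (prMeasure μ k w f₀ y i) (y i) - 1 with hd
  have hr0 : ∀ i u, 0 < r i u := fun i u => h.updateFactor_pos _ i _ u
  have hrm : ∀ i, Measurable (r i) := fun i => h.measurable_updateFactor _ _ _
  have hdens : ∀ n u, prDensity μ k w f₀ y n u = f₀ u * ∏ i ∈ Finset.range n, r i u := by
    intro n u
    induction n with
    | zero => simp [prDensity]
    | succ n ih => rw [h.prDensity_succ, ih, Finset.prod_range_succ, mul_assoc]
  have hPm : Measurable fun u => ∏ i ∈ Finset.range n, r i u :=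
    Finset.measurable_prod _ fun i _ => hrm i
  have hP0 : ∀ u, 0 < ∏ i ∈ Finset.range n, r i u := fun u =>
    Finset.prod_pos fun i _ => hr0 i u
  -- The product of the update factors is the density of the n-th mixing distribution relative to
  -- the initial one. Its integral under the latter is therefore one, and passing to `G` costs the
  -- factor `C`.
  have hPC : ∫⁻ u, ENNReal.ofReal (∏ i ∈ Finset.range n, r i u) ∂G ≤ C := by
    calc ∫⁻ u, ENNReal.ofReal (∏ i ∈ Finset.range n, r i u) ∂G
        ≤ ∫⁻ u, ENNReal.ofReal (∏ i ∈ Finset.range n, r i u) ∂(C • prMeasure μ k w f₀ y 0) :=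
          lintegral_mono' hG le_rfl
      _ = C * ∫⁻ u, ENNReal.ofReal (∏ i ∈ Finset.range n, r i u) ∂(prMeasure μ k w f₀ y 0) := by
          rw [lintegral_smul_measure, ENNReal.smul_def, smul_eq_mul]
      _ = C * prMeasure μ k w f₀ y n Set.univ := by
          congr 1
          rw [prMeasure_univ, h.lintegral_prMeasure y 0 hPm.ennreal_ofReal]
          refine lintegral_congr fun u => ?_
          rw [hdens n u, ENNReal.ofReal_mul (h.nonneg u)]
          rfl
      _ = C := by
          have := h.isProbabilityMeasure y n
          simp
  have hPi : Integrable (fun u => ∏ i ∈ Finset.range n, r i u) G := by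
    refine ⟨hPm.aestronglyMeasurable, ?_⟩
    rw [hasFiniteIntegral_iff_ofReal (ae_of_all _ fun u => (hP0 u).le)]
    exact hPC.trans_lt ENNReal.coe_lt_top
  have hPint : ∫ u, ∏ i ∈ Finset.range n, r i u ∂G ≤ C := by
    rw [integral_eq_lintegral_of_nonneg_ae (ae_of_all _ fun u => (hP0 u).le)
      hPm.aestronglyMeasurable]
    exact ENNReal.toReal_le_coe_of_le_coe hPC
  have hdm : ∀ i, Measurable (d i) := fun i => ((h.kernel.meas_right _).div_const _).sub_const 1
  have hdge : ∀ i u, -1 ≤ d i u := fun i u => by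
    have : 0 ≤ k (y i) u / mixture k (prMeasure μ k w f₀ y i) (y i) :=
      div_nonneg (h.kernel.nonneg _ u) (h.kernel.mixture_nonneg _ _)
    simp only [hd]; linarith
  have hdL : ∀ i, MemLp (d i) 2 G := fun i => by
    obtain ⟨B, hB⟩ := h.kernel.bdd (y i)
    refine MemLp.of_bound (hdm i).aestronglyMeasurable
      (B / mixture k (prMeasure μ k w f₀ y i) (y i) + 1) (ae_of_all _ fun u => ?_)
    have h1 : 0 ≤ k (y i) u / mixture k (prMeasure μ k w f₀ y i) (y i) :=
      div_nonneg (h.kernel.nonneg _ u) (h.kernel.mixture_nonneg _ _)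
    have h2 : k (y i) u / mixture k (prMeasure μ k w f₀ y i) (y i) ≤
        B / mixture k (prMeasure μ k w f₀ y i) (y i) :=
      div_le_div_of_nonneg_right (hB u) (h.kernel.mixture_nonneg _ _)
    simp only [hd, Real.norm_eq_abs, abs_le]
    constructor <;> linarith
  have hi1 : ∀ i, Integrable (d i) G := fun i => (hdL i).integrable one_le_two
  have hi2 : ∀ i, Integrable (fun u => d i u ^ 2) G := fun i => (hdL i).integrable_sq
  have hid : ∀ i, ∫ u, d i u ∂G =
      mixture k G (y i) / mixture k (prMeasure μ k w f₀ y i) (y i) - 1 := fun i => by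
    simp only [hd]
    rw [integral_sub ((h.kernel.integrable G _).div_const _) (integrable_const _), integral_div]
    simp [mixture]
  have hid2 : ∀ i, (∫⁻ u, ENNReal.ofReal (d i u ^ 2) ∂G).toReal = ∫ u, d i u ^ 2 ∂G := fun i => by
    rw [integral_eq_lintegral_of_nonneg_ae (ae_of_all _ fun u => sq_nonneg _)
      (hi2 i).aestronglyMeasurable]
  -- The sum is at most the log of the product, which is at most the product minus one; being
  -- pointwise, this can be integrated without knowing that the log is integrable.
  have hpt : ∀ u, ∑ i ∈ Finset.range n, (w i * d i u - w i ^ 2 / (1 - w i) * d i u ^ 2) ≤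
      ∏ i ∈ Finset.range n, r i u - 1 := by
    intro u
    calc _ ≤ ∑ i ∈ Finset.range n, Real.log (r i u) :=
          Finset.sum_le_sum fun i _ => log_one_add_mul_ge (h.weight i) (hdge i u)
      _ = Real.log (∏ i ∈ Finset.range n, r i u) :=
          (Real.log_prod fun i _ => (hr0 i u).ne').symm
      _ ≤ _ := Real.log_le_sub_one_of_pos (hP0 u)
  have hterm : ∀ i, Integrable (fun u => w i * d i u - w i ^ 2 / (1 - w i) * d i u ^ 2) G :=
    fun i => ((hi1 i).const_mul _).sub ((hi2 i).const_mul _)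
  have hmain : ∑ i ∈ Finset.range n, (w i * ∫ u, d i u ∂G - w i ^ 2 / (1 - w i) *
      ∫ u, d i u ^ 2 ∂G) ≤ (C : ℝ) - 1 := by
    calc _ = ∫ u, ∑ i ∈ Finset.range n, (w i * d i u - w i ^ 2 / (1 - w i) * d i u ^ 2) ∂G := by
          rw [integral_finsetSum _ fun i _ => hterm i]
          refine Finset.sum_congr rfl fun i _ => ?_
          rw [integral_sub ((hi1 i).const_mul _) ((hi2 i).const_mul _), integral_const_mul,
            integral_const_mul]
      _ ≤ ∫ u, (∏ i ∈ Finset.range n, r i u - 1) ∂G :=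
          integral_mono (integrable_finsetSum _ fun i _ => hterm i)
            (hPi.sub (integrable_const _)) hpt
      _ ≤ C - 1 := by
          rw [integral_sub hPi (integrable_const _)]
          simpa using hPint
  rw [Finset.sum_sub_distrib] at hmain
  simp only [hid, ← hid2] at hmain
  simp only [hd] at hmain
  linarith

end Invariants

end RegularRecursion

end

/-! ### Almost sure limits along the recursion -/

section

namespace RegularRecursion

variable {Ω U 𝒴 : Type*} [MeasurableSpace Ω] [MeasurableSpace U] [MeasurableSpace 𝒴]
variable {μ : Measure U} [SFinite μ] {k : 𝒴 → U → ℝ} {w : ℕ → ℝ} {f₀ : U → ℝ}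
variable {Q : Measure 𝒴} [IsProbabilityMeasure Q] {A : ℝ≥0} {c : 𝒴 → ℝ}
variable {P : Measure Ω} [IsProbabilityMeasure P] {Y : ℕ → Ω → 𝒴}

/-- The divergences of the predictive densities converge almost surely. -/
lemma ae_exists_tendsto_divergence (h : RegularRecursion μ Q k A w f₀)
    (hsq : Summable fun i => w i ^ 2) (hY : ∀ i, Measurable (Y i)) (hind : iIndepFun Y P)
    (hlaw : ∀ i, P.map (Y i) = Q)
    (hc : ∀ (F : Measure U) [IsProbabilityMeasure F],
      Integrable (fun y => c y - Real.log (mixture k F y)) Q) {L : ℝ}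
    (hL : ∀ y i, L ≤ divergence Q c k (prMeasure μ k w f₀ y i)) :
    ∀ᵐ ω ∂P, ∃ κ, Tendsto (fun n => divergence Q c k (prMeasure μ k w f₀ (fun j => Y j ω) n))
      atTop (𝓝 κ) := by
  have hpred := predictable_prMeasure (𝒴 := 𝒴) (μ := μ) (k := k) (w := w) (f₀ := f₀)
  set g : ℕ → (ℕ → 𝒴) → 𝒴 → ℝ := fun i y x' =>
    ∫ x, crossRatio k (prMeasure μ k w f₀ y i) x x' ∂Q with hg
  set z : ℕ → (ℕ → 𝒴) → 𝒴 → ℝ≥0∞ := fun i y x' =>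
    ∫⁻ x, ENNReal.ofReal ((crossRatio k (prMeasure μ k w f₀ y i) x x' - 1) ^ 2) ∂Q with hz
  have h1 := ae_tendsto_sum_sub_integral (g := g) (C := A ^ 2) hY hind hlaw
    (fun i y y' hy => by
      have := hpred i y y' hy
      simp only at this
      simp only [hg, this])
    (fun i => (h.measurable_crossRatio_prMeasure i).stronglyMeasurable.integral_prod_right.measurable)
    (fun i y => by
      have := h.isProbabilityMeasure y i
      exact h.kernel.lintegral_integral_crossRatio_sq_le _) hsq
  have h2 := ae_tsum_lt_top (g := z) (C := (A ^ 2 + 1 : ℝ≥0)) hY hind hlaw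
    (fun i y y' hy => by
      have := hpred i y y' hy
      simp only at this
      simp only [hz, this])
    (fun i => (((h.measurable_crossRatio_prMeasure i).sub_const 1).pow_const
      2).ennreal_ofReal.lintegral_prod_right') ENNReal.coe_ne_top
    (fun i y => by
      have := h.isProbabilityMeasure y i
      exact h.kernel.lintegral_crossRatio_sub_one_sq_le _) (summable_sq_div_one_sub hsq)
  filter_upwards [h1, h2] with ω ⟨l, hl⟩ hsum
  have hapos : ∀ i, 0 < w i ^ 2 / (1 - w i) := fun i =>
    div_pos (pow_pos (h.weight i).1 2) (by linarith [(h.weight i).2])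
  -- The coefficients are strictly positive, so one infinite term would make the series infinite.
  have hfin : ∀ i, z i (fun j => Y j ω) (Y i ω) ≠ ∞ := fun i hi => by
    have := ENNReal.ne_top_of_tsum_ne_top hsum.ne i
    rw [hi] at this
    exact this (ENNReal.mul_top (by simpa using hapos i))
  have hb : Summable fun i => w i ^ 2 / (1 - w i) * (z i (fun j => Y j ω) (Y i ω)).toReal := by
    refine (ENNReal.summable_toReal hsum.ne).congr fun i => ?_
    rw [ENNReal.toReal_mul, ENNReal.toReal_ofReal (hapos i).le]
  refine exists_tendsto_of_almost_decreasing (fun i => (h.weight i).1.le) (fun n => hL _ n)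
    (T := fun i => ∫ x', g i (fun j => Y j ω) x' ∂Q) (fun i => ?_) hb hl fun n => ?_
  · have := h.isProbabilityMeasure (fun j => Y j ω) i
    exact h.kernel.one_le_integral_crossRatio (h.mixture_prMeasure_pos _ i)
  · have := h.isProbabilityMeasure (fun j => Y j ω) n
    have := h.isProbabilityMeasure (fun j => Y j ω) (n + 1)
    exact h.kernel.divergence_update_le (hc _) (h.weight n)
      (h.mixture_prMeasure_succ (fun j => Y j ω) n) (hfin n)

/-- The limit of the divergences of the predictive densities is at most the divergence of every
mixture whose mixing distribution has a bounded density with respect to the initial one. -/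
lemma ae_le_divergence_of_tendsto (h : RegularRecursion μ Q k A w f₀)
    (hwsum : Tendsto (fun n => ∑ i ∈ Finset.range n, w i) atTop atTop)
    (hsq : Summable fun i => w i ^ 2) (hY : ∀ i, Measurable (Y i)) (hind : iIndepFun Y P)
    (hlaw : ∀ i, P.map (Y i) = Q)
    (hc : ∀ (F : Measure U) [IsProbabilityMeasure F],
      Integrable (fun y => c y - Real.log (mixture k F y)) Q)
    (G : Measure U) [IsProbabilityMeasure G] {C : ℝ≥0}
    (hG : G ≤ C • μ.withDensity fun u => ENNReal.ofReal (f₀ u)) :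
    ∀ᵐ ω ∂P, ∀ κ, Tendsto (fun n => divergence Q c k (prMeasure μ k w f₀ (fun j => Y j ω) n))
      atTop (𝓝 κ) → κ ≤ divergence Q c k G := by
  have hpred := predictable_prMeasure (𝒴 := 𝒴) (μ := μ) (k := k) (w := w) (f₀ := f₀)
  set g : ℕ → (ℕ → 𝒴) → 𝒴 → ℝ := fun i y x =>
    mixture k G x / mixture k (prMeasure μ k w f₀ y i) x with hg
  set z : ℕ → (ℕ → 𝒴) → 𝒴 → ℝ≥0∞ := fun i y x =>
    ∫⁻ u, ENNReal.ofReal ((k x u / mixture k (prMeasure μ k w f₀ y i) x - 1) ^ 2) ∂G with hz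
  have h1 := ae_tendsto_sum_sub_integral (g := g) (C := A) hY hind hlaw
    (fun i y y' hy => by
      have := hpred i y y' hy
      simp only at this
      simp only [hg, this])
    (fun i => ((h.kernel.measurable_mixture G).comp measurable_snd).div
      (h.measurable_mixture_prMeasure i))
    (fun i y => by
      have := h.isProbabilityMeasure y i
      exact h.kernel.lintegral_ratio_sq_le _ G) hsq
  have hzm : ∀ i, Measurable fun q : ((ℕ → 𝒴) × 𝒴) × U => ENNReal.ofReal
      ((k q.1.2 q.2 / mixture k (prMeasure μ k w f₀ q.1.1 i) q.1.2 - 1) ^ 2) := fun i =>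
    ((((h.kernel.meas.comp ((measurable_snd.comp measurable_fst).prodMk measurable_snd)).div
      ((h.measurable_mixture_prMeasure i).comp measurable_fst)).sub_const 1).pow_const
        2).ennreal_ofReal
  have h2 := ae_tsum_lt_top (g := z) (C := (A + 1 : ℝ≥0)) hY hind hlaw
    (fun i y y' hy => by
      have := hpred i y y' hy
      simp only at this
      simp only [hz, this])
    (fun i => (hzm i).lintegral_prod_right') ENNReal.coe_ne_top
    (fun i y => by
      have := h.isProbabilityMeasure y i
      set F := prMeasure μ k w f₀ y i
      have hm : Measurable fun q : 𝒴 × U => ENNReal.ofReal ((k q.1 q.2 / mixture k F q.1 - 1) ^ 2) :=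
        (((h.kernel.measurable_kernel_ratio F).sub_const 1).pow_const 2).ennreal_ofReal
      calc ∫⁻ x, ∫⁻ u, ENNReal.ofReal ((k x u / mixture k F x - 1) ^ 2) ∂G ∂Q
          = ∫⁻ u, ∫⁻ x, ENNReal.ofReal ((k x u / mixture k F x - 1) ^ 2) ∂Q ∂G :=
            lintegral_lintegral_swap hm.aemeasurable
        _ ≤ ∫⁻ u, ∫⁻ x, (ENNReal.ofReal ((k x u / mixture k F x) ^ 2) + 1) ∂Q ∂G :=
            lintegral_mono fun u => lintegral_mono fun x => ofReal_sub_one_sq_le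
              (div_nonneg (h.kernel.nonneg x u) (h.kernel.mixture_nonneg F x))
        _ ≤ ∫⁻ _, (A + 1) ∂G := by
            refine lintegral_mono fun u => ?_
            rw [lintegral_add_right _ measurable_const]
            simp only [lintegral_const, measure_univ, mul_one]
            gcongr
            exact h.kernel.lintegral_kernel_ratio_sq_le F u
        _ = _ := by simp) (summable_sq_div_one_sub hsq)
  filter_upwards [h1, h2] with ω ⟨l, hl⟩ hsum κ hκ
  have hapos : ∀ i, 0 ≤ w i ^ 2 / (1 - w i) := fun i =>
    div_nonneg (sq_nonneg _) (by linarith [(h.weight i).2])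
  have hb : Summable fun i => w i ^ 2 / (1 - w i) * (z i (fun j => Y j ω) (Y i ω)).toReal := by
    refine (ENNReal.summable_toReal hsum.ne).congr fun i => ?_
    rw [ENNReal.toReal_mul, ENNReal.toReal_ofReal (hapos i)]
  obtain ⟨B, hB⟩ := hl.bddBelow_range
  refine le_of_sum_mul_sub_bounded (fun i => (h.weight i).1.le) hwsum hκ
    (B := C - 1 + (∑' i, w i ^ 2 / (1 - w i) * (z i (fun j => Y j ω) (Y i ω)).toReal) - B)
    fun n => ?_
  have h3 := h.sum_weight_mul_ratio_le (fun j => Y j ω) hG n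
  have h4 : ∑ i ∈ Finset.range n, w i ^ 2 / (1 - w i) * (z i (fun j => Y j ω) (Y i ω)).toReal ≤
      ∑' i, w i ^ 2 / (1 - w i) * (z i (fun j => Y j ω) (Y i ω)).toReal :=
    hb.sum_le_tsum _ fun i _ => mul_nonneg (hapos i) ENNReal.toReal_nonneg
  have h5 := hB ⟨n, rfl⟩
  -- The divergence gap is a mean log-ratio, so log x ≤ x - 1 bounds it by the conditional mean of
  -- the linear term.
  have h6 : ∑ i ∈ Finset.range n, w i *
        (divergence Q c k (prMeasure μ k w f₀ (fun j => Y j ω) i) - divergence Q c k G) ≤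
      ∑ i ∈ Finset.range n, w i * (∫ x, g i (fun j => Y j ω) x ∂Q - 1) := by
    refine Finset.sum_le_sum fun i _ => mul_le_mul_of_nonneg_left ?_ (h.weight i).1.le
    have := h.isProbabilityMeasure (fun j => Y j ω) i
    rw [h.kernel.divergence_eq_add _ G (hc G), add_sub_cancel_left]
    exact h.kernel.integral_log_ratio_le _ G
  have h7 : ∑ i ∈ Finset.range n, w i * (∫ x, g i (fun j => Y j ω) x ∂Q - 1) =
      ∑ i ∈ Finset.range n, w i * (g i (fun j => Y j ω) (Y i ω) - 1) -
      ∑ i ∈ Finset.range n, w i *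
        (g i (fun j => Y j ω) (Y i ω) - ∫ x, g i (fun j => Y j ω) x ∂Q) := by
    rw [← Finset.sum_sub_distrib]
    exact Finset.sum_congr rfl fun i _ => by ring
  simp only at h5
  simp only [hz] at h4 ⊢
  linarith

variable [TopologicalSpace U] [TopologicalSpace.MetrizableSpace U] [SecondCountableTopology U]
  [BorelSpace U]

/-- The divergences of the predictive densities converge almost surely to the smallest divergence
over the closure of the mixing densities. -/
lemma ae_tendsto_divergence (h : RegularRecursion μ Q k A w f₀)
    (hcont : ∀ y, Continuous (k y))
    (hsupp : ∀ O : Set U, IsOpen O → μ O ≠ 0 → ∫⁻ u in O, ENNReal.ofReal (f₀ u) ∂μ ≠ 0)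
    (hwsum : Tendsto (fun n => ∑ i ∈ Finset.range n, w i) atTop atTop)
    (hsq : Summable fun i => w i ^ 2) (hY : ∀ i, Measurable (Y i)) (hind : iIndepFun Y P)
    (hlaw : ∀ i, P.map (Y i) = Q)
    (hc : ∀ (F : Measure U) [IsProbabilityMeasure F],
      Integrable (fun y => c y - Real.log (mixture k F y)) Q) {κ : ℝ}
    (hκ : IsGLB ((fun F : ProbabilityMeasure U => divergence Q c k (F : Measure U)) ''
      mixingClosure μ) κ) :
    ∀ᵐ ω ∂P, Tendsto (fun n => divergence Q c k (prMeasure μ k w f₀ (fun j => Y j ω) n))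
      atTop (𝓝 κ) := by
  have hL : ∀ y i, κ ≤ divergence Q c k (prMeasure μ k w f₀ y i) := fun y i =>
    hκ.1 ⟨_, subset_closure (h.prMeasure_mem_mixingDensities y i), rfl⟩
  obtain ⟨ω₀⟩ : Nonempty Ω := nonempty_of_isProbabilityMeasure P
  set F₀ : Measure U := μ.withDensity fun u => ENNReal.ofReal (f₀ u) with hF₀
  have hF₀p : IsProbabilityMeasure F₀ := h.isProbabilityMeasure (fun j => Y j ω₀) 0
  have hsupp' : ∀ O : Set U, IsOpen O → μ O ≠ 0 → F₀ O ≠ 0 := fun O hO hμO => by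
    rw [hF₀, withDensity_apply _ hO.measurableSet]
    exact hsupp O hO hμO
  -- Otherwise κ + 1 / (n + 1) would be a lower bound over the bounded densities, hence over the
  -- closure, contradicting the choice of κ.
  have happrox : ∀ n : ℕ, ∃ G : Measure U, IsProbabilityMeasure G ∧ (∃ C : ℝ≥0, G ≤ C • F₀) ∧
      divergence Q c k G < κ + (n + 1 : ℝ)⁻¹ := by
    intro n
    by_contra! hcon
    have : κ + (n + 1 : ℝ)⁻¹ ≤ κ := by
      refine hκ.2 ?_
      rintro _ ⟨F, hF, rfl⟩
      exact h.kernel.le_divergence_of_mem_mixingClosure hcont hsupp' (hc F₀)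
        (fun G hGp C hG => hcon G hGp ⟨C, hG⟩) hF
    have h2 : 0 < (n + 1 : ℝ)⁻¹ := by positivity
    linarith
  choose G hGp hGC hGlt using happrox
  choose C hGC using hGC
  -- The exceptional null set depends on the competitor, so only countably many competitors are
  -- used.
  have hle : ∀ᵐ ω ∂P, ∀ m, ∀ κ', Tendsto (fun n => divergence Q c k
      (prMeasure μ k w f₀ (fun j => Y j ω) n)) atTop (𝓝 κ') → κ' ≤ divergence Q c k (G m) :=
    ae_all_iff.2 fun m => h.ae_le_divergence_of_tendsto hwsum hsq hY hind hlaw hc (G m) (hGC m)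
  filter_upwards [h.ae_exists_tendsto_divergence hsq hY hind hlaw hc hL, hle] with ω ⟨κ', hκ'⟩ hω
  have h1 : κ ≤ κ' := ge_of_tendsto' hκ' fun n => hL _ n
  have h2 : κ' ≤ κ := by
    have hlim : Tendsto (fun m : ℕ => κ + (m + 1 : ℝ)⁻¹) atTop (𝓝 (κ + 0)) := by
      refine tendsto_const_nhds.add ?_
      simpa using tendsto_one_div_add_atTop_nhds_zero_nat (𝕜 := ℝ)
    rw [add_zero] at hlim
    exact ge_of_tendsto' hlim fun m => (hω m κ' hκ').trans (hGlt m).le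
  rwa [le_antisymm h1 h2]

/-- The normalized log-likelihood ratio of the predictive densities converges almost surely to the
smallest divergence. -/
lemma ae_tendsto_average_log (h : RegularRecursion μ Q k A w f₀)
    (hcont : ∀ y, Continuous (k y))
    (hsupp : ∀ O : Set U, IsOpen O → μ O ≠ 0 → ∫⁻ u in O, ENNReal.ofReal (f₀ u) ∂μ ≠ 0)
    (hwsum : Tendsto (fun n => ∑ i ∈ Finset.range n, w i) atTop atTop)
    (hsq : Summable fun i => w i ^ 2) (hY : ∀ i, Measurable (Y i)) (hind : iIndepFun Y P)
    (hlaw : ∀ i, P.map (Y i) = Q) (hcm : Measurable c)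
    (hc : ∀ (F : Measure U) [IsProbabilityMeasure F],
      Integrable (fun y => c y - Real.log (mixture k F y)) Q) {κ : ℝ}
    (hκ : IsGLB ((fun F : ProbabilityMeasure U => divergence Q c k (F : Measure U)) ''
      mixingClosure μ) κ) :
    ∀ᵐ ω ∂P, Tendsto (fun n : ℕ => (n : ℝ)⁻¹ * ∑ i ∈ Finset.range n,
      (c (Y i ω) - Real.log (prMixture μ k w f₀ (fun j => Y j ω) i (Y i ω)))) atTop (𝓝 κ) := by
  have hpred := predictable_prMeasure (𝒴 := 𝒴) (μ := μ) (k := k) (w := w) (f₀ := f₀)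
  obtain ⟨ω₀⟩ : Nonempty Ω := nonempty_of_isProbabilityMeasure P
  set F₀ : Measure U := μ.withDensity fun u => ENNReal.ofReal (f₀ u) with hF₀
  have hF₀p : IsProbabilityMeasure F₀ := h.isProbabilityMeasure (fun j => Y j ω₀) 0
  have hF₀pos : ∀ x, 0 < mixture k F₀ x := fun x =>
    h.mixture_pos_of_absolutelyContinuous (withDensity_absolutelyContinuous _ _) x
  -- Comparing with the fixed mixture of `F₀` splits the summand in two. The log-ratio of mixtures
  -- has uniformly bounded second moments, as the martingale law requires; the rest, c - log m_{F₀},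
  -- is i.i.d. and merely integrable, which the strong law allows.
  set g : ℕ → (ℕ → 𝒴) → 𝒴 → ℝ := fun i y x =>
    Real.log (mixture k F₀ x / mixture k (prMeasure μ k w f₀ y i) x) with hg
  have h1 := ae_tendsto_average_sub_integral (g := g) (C := 2 * A) hY hind hlaw
    (fun i y y' hy => by
      have := hpred i y y' hy
      simp only at this
      simp only [hg, this])
    (fun i => (((h.kernel.measurable_mixture F₀).comp measurable_snd).div
      (h.measurable_mixture_prMeasure i)).log)
    (fun i y => by
      have := h.isProbabilityMeasure y i
      exact h.kernel.lintegral_log_ratio_sq_le _ F₀)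
  set e : 𝒴 → ℝ := fun x => c x - Real.log (mixture k F₀ x) with he
  have hem : Measurable e := hcm.sub (h.kernel.measurable_mixture F₀).log
  have hei : Integrable e (P.map (Y 0)) := by rw [hlaw]; exact hc F₀
  have h2 := strong_law_ae (μ := P) (fun i ω => e (Y i ω))
    ((integrable_map_measure hem.aestronglyMeasurable (hY 0).aemeasurable).1 hei)
    (fun i j hij => (hind.indepFun hij).comp hem hem)
    (fun i => (IdentDistrib.mk (hY i).aemeasurable (hY 0).aemeasurable
      (by rw [hlaw, hlaw])).comp hem)
  have h2' : ∫ ω, e (Y 0 ω) ∂P = divergence Q c k F₀ := by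
    rw [divergence, ← hlaw 0, integral_map (hY 0).aemeasurable hem.aestronglyMeasurable]
  rw [h2'] at h2
  filter_upwards [h1, h2, h.ae_tendsto_divergence hcont hsupp hwsum hsq hY hind hlaw hc hκ]
    with ω hω1 hω2 hω3
  -- The conditional mean of the log-ratio is D(F_i) - D(F₀). The Cesàro limit of D(F_i) restores
  -- it, and D(F₀) cancels against the strong-law limit.
  have h3 := hω1.add (hω2.add (hω3.cesaro.sub (tendsto_const_nhds (x := divergence Q c k F₀))))
  have e0 : 0 + (divergence Q c k F₀ + (κ - divergence Q c k F₀)) = κ := by ring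
  rw [e0] at h3
  refine h3.congr' ?_
  filter_upwards [eventually_gt_atTop 0] with n hn
  have hn' : (n : ℝ) ≠ 0 := by positivity
  have e1 : divergence Q c k F₀ =
      (n : ℝ)⁻¹ * ∑ _i ∈ Finset.range n, divergence Q c k F₀ := by
    rw [Finset.sum_const, Finset.card_range, nsmul_eq_mul, inv_mul_cancel_left₀ hn']
  conv_lhs => rw [e1]
  rw [smul_eq_mul, ← mul_sub, ← mul_add, ← mul_add, ← Finset.sum_sub_distrib,
    ← Finset.sum_add_distrib, ← Finset.sum_add_distrib]
  congr 1
  refine Finset.sum_congr rfl fun i _ => ?_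
  have := h.isProbabilityMeasure (fun j => Y j ω) i
  rw [h.kernel.divergence_eq_add (prMeasure μ k w f₀ (fun j => Y j ω) i) F₀ (hc F₀),
    h.prMixture_eq]
  simp only [hg, he]
  rw [Real.log_div (hF₀pos _).ne' (h.mixture_prMeasure_pos _ i _).ne']
  ring

end RegularRecursion

end

/-! ### The Kullback–Leibler divergence as an integral of logarithms -/

section Divergence

variable {𝒴 : Type*} [MeasurableSpace 𝒴] {ν : Measure 𝒴} {m g : 𝒴 → ℝ}

/-- A finite divergence of probability densities is the integral of the log-ratio. -/
lemma KL_eq_integral (hm : Measurable m)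
    (hm1 : ∫⁻ y, ENNReal.ofReal (m y) ∂ν = 1) (hg : Measurable g)
    (hg1 : ∫⁻ y, ENNReal.ofReal (g y) ∂ν = 1) (hKL : KL ν m g ≠ ∞) :
    (∀ᵐ y ∂(ν.withDensity fun y => ENNReal.ofReal (m y)), 0 < g y) ∧
    Integrable (fun y => Real.log (m y) - Real.log (g y))
      (ν.withDensity fun y => ENNReal.ofReal (m y)) ∧
    (KL ν m g).toReal = ∫ y, (Real.log (m y) - Real.log (g y))
      ∂(ν.withDensity fun y => ENNReal.ofReal (m y)) := by
  set Q := ν.withDensity fun y => ENNReal.ofReal (m y) with hQ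
  set ρ := ν.withDensity fun y => ENNReal.ofReal (g y) with hρ
  have hQp : IsProbabilityMeasure Q :=
    ⟨by rw [hQ, withDensity_apply _ MeasurableSet.univ, setLIntegral_univ, hm1]⟩
  have hρp : IsProbabilityMeasure ρ :=
    ⟨by rw [hρ, withDensity_apply _ MeasurableSet.univ, setLIntegral_univ, hg1]⟩
  have hKL' : InformationTheory.klDiv Q ρ ≠ ∞ := hKL
  obtain ⟨hac, hint⟩ := InformationTheory.klDiv_ne_top_iff.1 hKL'
  have hρpos : ∀ᵐ y ∂ρ, 0 < g y := by
    rw [hρ, ae_withDensity_iff hg.ennreal_ofReal]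
    exact ae_of_all _ fun y hy => by simpa using hy
  have hQpos : ∀ᵐ y ∂Q, 0 < g y := hac hρpos
  have hQm : ∀ᵐ y ∂Q, 0 < m y := by
    rw [hQ, ae_withDensity_iff hm.ennreal_ofReal]
    exact ae_of_all _ fun y hy => by simpa using hy
  have hφ : Measurable fun y => ENNReal.ofReal (m y) / ENNReal.ofReal (g y) :=
    hm.ennreal_ofReal.div hg.ennreal_ofReal
  have hQρ : Q = ρ.withDensity fun y => ENNReal.ofReal (m y) / ENNReal.ofReal (g y) := by
    rw [hρ, ← withDensity_mul _ hg.ennreal_ofReal hφ, hQ]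
    refine withDensity_congr_ae ?_
    -- Absolute continuity now reads: `g` is positive `ν`-almost everywhere where `m` is; elsewhere
    -- both densities vanish.
    rw [hQ, ae_withDensity_iff hm.ennreal_ofReal] at hQpos
    filter_upwards [hQpos] with y hy
    by_cases h0 : ENNReal.ofReal (m y) = 0
    · simp [h0]
    · exact (ENNReal.mul_div_cancel (by simpa using hy h0) ENNReal.ofReal_ne_top).symm
  have hllr : llr Q ρ =ᵐ[Q] fun y => Real.log (m y) - Real.log (g y) := by
    have h1 : Q.rnDeriv ρ =ᵐ[ρ] fun y => ENNReal.ofReal (m y) / ENNReal.ofReal (g y) := by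
      conv_lhs => rw [hQρ]
      exact Measure.rnDeriv_withDensity ρ hφ
    filter_upwards [hac.ae_eq h1, hQpos, hQm] with y h2 h3 h4
    rw [llr, h2, ENNReal.toReal_div, ENNReal.toReal_ofReal h3.le, ENNReal.toReal_ofReal h4.le,
      Real.log_div h4.ne' h3.ne']
  refine ⟨hQpos, hint.congr hllr, ?_⟩
  rw [← integral_congr_ae hllr]
  exact InformationTheory.toReal_klDiv_of_measure_eq hac (by simp)

end Divergence

/-! ### Positivity of the kernel and removal of a null set of observations -/

section Kernel

variable {Ω U 𝒴 : Type*} [MeasurableSpace Ω] [MeasurableSpace U] [MeasurableSpace 𝒴]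

lemma lintegral_mixture_eq_one {ν : Measure 𝒴} [SFinite ν] {k : 𝒴 → U → ℝ}
    (hk : Measurable (Function.uncurry k)) (hk0 : ∀ y u, 0 ≤ k y u)
    (hkb : ∀ y, ∃ C : ℝ, ∀ u, k y u ≤ C) (hk1 : ∀ u, ∫⁻ y, ENNReal.ofReal (k y u) ∂ν = 1)
    (F : Measure U) [IsProbabilityMeasure F] :
    ∫⁻ y, ENNReal.ofReal (mixture k F y) ∂ν = 1 := by
  have h1 : ∀ y, ENNReal.ofReal (mixture k F y) = ∫⁻ u, ENNReal.ofReal (k y u) ∂F := by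
    intro y
    obtain ⟨C, hC⟩ := hkb y
    refine ofReal_integral_eq_lintegral_ofReal (Integrable.of_bound
      (hk.comp measurable_prodMk_left).aestronglyMeasurable C (ae_of_all _ fun u => ?_))
      (ae_of_all _ (hk0 y))
    rw [Real.norm_eq_abs]
    exact (abs_of_nonneg (hk0 y u)).trans_le (hC u)
  simp only [h1]
  rw [lintegral_lintegral_swap hk.ennreal_ofReal.aemeasurable]
  simp [hk1]

lemma ae_ae_pos {Q : Measure 𝒴} [SFinite Q] {k : 𝒴 → U → ℝ} (hk : Measurable (Function.uncurry k))
    (hpos : ∀ u, ∀ᵐ y ∂Q, 0 < k y u) (F : Measure U) [SFinite F] :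
    ∀ᵐ y ∂Q, ∀ᵐ u ∂F, 0 < k y u := by
  have h1 : MeasurableSet {z : U × 𝒴 | 0 < k z.2 z.1} :=
    measurableSet_lt measurable_const (hk.comp measurable_swap)
  exact (Measure.ae_ae_comm h1).1 (ae_of_all _ hpos)

/-- If some mixture is positive almost everywhere and the likelihood ratios are square-integrable,
then the kernel is positive almost everywhere. -/
lemma ae_pos_of_ratio {Q : Measure 𝒴} [SFinite Q] {k : 𝒴 → U → ℝ}
    (hk : Measurable (Function.uncurry k)) (hk0 : ∀ y u, 0 ≤ k y u) {A : ℝ≥0}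
    (hratio : ∀ u₁ u₂,
      ∫⁻ y, (ENNReal.ofReal (k y u₁) / ENNReal.ofReal (k y u₂)) ^ 2 ∂Q ≤ A)
    (F : Measure U) [IsProbabilityMeasure F] (hF : ∀ᵐ y ∂Q, 0 < mixture k F y) (v : U) :
    ∀ᵐ y ∂Q, 0 < k y v := by
  have hkv : ∀ v, Measurable fun y => k y v := fun v => hk.comp measurable_prodMk_right
  -- A positive number over zero is ∞ in `ℝ≥0∞`, so a finite integral of the squared ratio forbids
  -- this outside a null set.
  have h1 : ∀ u, ∀ᵐ y ∂Q, k y v = 0 → k y u = 0 := by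
    intro u
    have hm : Measurable fun y => (ENNReal.ofReal (k y u) / ENNReal.ofReal (k y v)) ^ 2 :=
      ((hkv u).ennreal_ofReal.div (hkv v).ennreal_ofReal).pow_const 2
    filter_upwards [ae_lt_top hm (ne_top_of_le_ne_top ENNReal.coe_ne_top (hratio u v))] with y hy hv
    by_contra hne
    have h2 : ENNReal.ofReal (k y u) ≠ 0 := by
      simpa using (hk0 y u).lt_of_ne' hne
    simp [hv, ENNReal.div_zero h2] at hy
  have hms : MeasurableSet {z : U × 𝒴 | k z.2 v = 0 → k z.2 z.1 = 0} := by
    have e : {z : U × 𝒴 | k z.2 v = 0 → k z.2 z.1 = 0} =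
        {z | k z.2 v = 0}ᶜ ∪ {z | k z.2 z.1 = 0} := by
      ext z; simp [imp_iff_not_or]
    rw [e]
    exact (measurableSet_eq_fun ((hkv v).comp measurable_snd) measurable_const).compl.union
      (measurableSet_eq_fun (hk.comp measurable_swap) measurable_const)
  have h2 : ∀ᵐ y ∂Q, ∀ᵐ u ∂F, k y v = 0 → k y u = 0 :=
    (Measure.ae_ae_comm hms).1 (ae_of_all _ h1)
  filter_upwards [h2, hF] with y hy hFy
  refine (hk0 y v).lt_of_ne' fun hv => ?_
  have : mixture k F y = 0 := integral_eq_zero_of_ae (hy.mono fun u hu => hu hv)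
  exact hFy.ne' this

/-- The kernel made constant at the observations in `N`. -/
noncomputable def trivializeOn (N : Set 𝒴) (k : 𝒴 → U → ℝ) : 𝒴 → U → ℝ :=
  open Classical in fun y u => if y ∈ N then 1 else k y u

lemma trivializeOn_of_notMem {N : Set 𝒴} {k : 𝒴 → U → ℝ} {y : 𝒴} (h : y ∉ N) :
    trivializeOn N k y = k y := by
  funext u; simp [trivializeOn, h]

lemma trivializeOn_of_mem {N : Set 𝒴} {k : 𝒴 → U → ℝ} {y : 𝒴} (h : y ∈ N) (u : U) :
    trivializeOn N k y u = 1 := by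
  simp [trivializeOn, h]

lemma prDensity_trivializeOn {μ : Measure U} {N : Set 𝒴} {k : 𝒴 → U → ℝ} {w : ℕ → ℝ} {f₀ : U → ℝ}
    {y : ℕ → 𝒴} (hy : ∀ j, y j ∉ N) (i : ℕ) :
    prDensity μ (trivializeOn N k) w f₀ y i = prDensity μ k w f₀ y i := by
  induction i with
  | zero => rfl
  | succ i ih => funext u; simp only [prDensity, ih, trivializeOn_of_notMem (hy i)]

lemma regularKernel_trivializeOn {Q : Measure 𝒴} {N : Set 𝒴} (hN : MeasurableSet N)
    (hQN : Q N = 0) {k : 𝒴 → U → ℝ} (hk : Measurable (Function.uncurry k))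
    (hk0 : ∀ y u, 0 ≤ k y u) (hkb : ∀ y, ∃ C : ℝ, ∀ u, k y u ≤ C)
    (hpos : ∀ u, ∀ᵐ y ∂Q, 0 < k y u) {A : ℝ≥0} (hratio : ∀ u₁ u₂,
      ∫⁻ y, (ENNReal.ofReal (k y u₁) / ENNReal.ofReal (k y u₂)) ^ 2 ∂Q ≤ A) :
    RegularKernel Q (trivializeOn N k) A := by
  have hae : ∀ᵐ y ∂Q, y ∉ N := measure_eq_zero_iff_ae_notMem.1 hQN
  refine ⟨?_, fun y u => ?_, fun y => ?_, fun u => ?_, fun u₁ u₂ => ?_⟩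
  · classical
    exact Measurable.ite (measurable_fst hN) measurable_const hk
  · by_cases hy : y ∈ N
    · rw [trivializeOn_of_mem hy]; exact zero_le_one
    · rw [trivializeOn_of_notMem hy]; exact hk0 y u
  · by_cases hy : y ∈ N
    · exact ⟨1, fun u => (trivializeOn_of_mem hy u).le⟩
    · rw [trivializeOn_of_notMem hy]; exact hkb y
  · filter_upwards [hae, hpos u] with y hy hyu
    rwa [trivializeOn_of_notMem hy]
  · refine le_trans (lintegral_mono_ae ?_) (hratio u₁ u₂)
    filter_upwards [hae] with y hy
    rw [trivializeOn_of_notMem hy]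

end Kernel

/-! ### The limit of the log-likelihood for one kernel -/

section Consistency

variable {Ω U 𝒴 : Type*} [MeasurableSpace Ω] [MeasurableSpace U] [MeasurableSpace 𝒴]
  [TopologicalSpace U] [TopologicalSpace.MetrizableSpace U] [SecondCountableTopology U]
  [BorelSpace U]
  {P : Measure Ω} [IsProbabilityMeasure P] {ν : Measure 𝒴} [SigmaFinite ν]
  {μ : Measure U} [SigmaFinite μ]

/-- The normalized log-likelihood of predictive recursion, relative to the true density, converges
almost surely to the smallest Kullback--Leibler divergence. -/
lemma ae_tendsto_average_log_prMixture {k : 𝒴 → U → ℝ} (hk : Measurable (Function.uncurry k))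
    (hk0 : ∀ y u, 0 ≤ k y u) (hk1 : ∀ u, ∫⁻ y, ENNReal.ofReal (k y u) ∂ν = 1)
    {f₀ : U → ℝ} (hf : Measurable f₀) (hf0 : ∀ u, 0 ≤ f₀ u)
    (hf1 : ∫⁻ u, ENNReal.ofReal (f₀ u) ∂μ = 1)
    (hsupp : ∀ O : Set U, IsOpen O → μ O ≠ 0 → ∫⁻ u in O, ENNReal.ofReal (f₀ u) ∂μ ≠ 0)
    {w : ℕ → ℝ} (hw : ∀ i, w i ∈ Set.Ioo (0 : ℝ) 1)
    {m : 𝒴 → ℝ} (hm : Measurable m)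
    {Y : ℕ → Ω → 𝒴} (hY : ∀ i, Measurable (Y i)) (hind : iIndepFun Y P)
    (hlaw : ∀ i, P.map (Y i) = ν.withDensity fun y => ENNReal.ofReal (m y))
    (hKL : ∀ F ∈ mixingClosure μ, KL ν m (mixture k (F : Measure U)) ≠ ∞)
    (hwsum : Tendsto (fun n => ∑ i ∈ Finset.range n, w i) atTop atTop)
    (hsq : Summable fun i => w i ^ 2)
    (hcont : ∀ y, Continuous (k y)) (hkb : ∀ y, ∃ C : ℝ, ∀ u, k y u ≤ C)
    {A : ℝ≥0} (hratio : ∀ u₁ u₂,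
      ∫⁻ y, (ENNReal.ofReal (k y u₁) / ENNReal.ofReal (k y u₂)) ^ 2
        * ENNReal.ofReal (m y) ∂ν ≤ A) :
    KStar μ ν m k ≠ ∞ ∧ ∀ᵐ ω ∂P, (∀ i, 0 < prMixture μ k w f₀ (fun j => Y j ω) i (Y i ω)) ∧
      Tendsto (fun n : ℕ => (n : ℝ)⁻¹ * ∑ i ∈ Finset.range n,
        (Real.log (m (Y i ω)) - Real.log (prMixture μ k w f₀ (fun j => Y j ω) i (Y i ω))))
        atTop (𝓝 (KStar μ ν m k).toReal) := by
  set Q : Measure 𝒴 := ν.withDensity fun y => ENNReal.ofReal (m y) with hQ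
  have hQp : IsProbabilityMeasure Q := by
    rw [← hlaw 0]; exact Measure.isProbabilityMeasure_map (hY 0).aemeasurable
  have hm1 : ∫⁻ y, ENNReal.ofReal (m y) ∂ν = 1 := by
    rw [← setLIntegral_univ, ← withDensity_apply _ MeasurableSet.univ]; exact hQp.measure_univ
  have hratioQ : ∀ u₁ u₂,
      ∫⁻ y, (ENNReal.ofReal (k y u₁) / ENNReal.ofReal (k y u₂)) ^ 2 ∂Q ≤ A := fun u₁ u₂ => by
    have hmu : ∀ u, Measurable fun y => ENNReal.ofReal (k y u) := fun u =>
      (hk.comp measurable_prodMk_right).ennreal_ofReal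
    have hmr : Measurable fun y => (ENNReal.ofReal (k y u₁) / ENNReal.ofReal (k y u₂)) ^ 2 :=
      ((hmu u₁).div (hmu u₂)).pow_const 2
    rw [hQ, lintegral_withDensity_eq_lintegral_mul _ hm.ennreal_ofReal hmr]
    refine le_trans (le_of_eq (lintegral_congr fun y => ?_)) (hratio u₁ u₂)
    simp only [Pi.mul_apply, mul_comm]
  set F₀ : Measure U := μ.withDensity fun u => ENNReal.ofReal (f₀ u) with hF₀
  have hF₀p : IsProbabilityMeasure F₀ :=
    ⟨by rw [hF₀, withDensity_apply _ MeasurableSet.univ, setLIntegral_univ, hf1]⟩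
  have hF₀mem : (⟨F₀, hF₀p⟩ : ProbabilityMeasure U) ∈ mixingClosure μ := by
    have : (⟨F₀, hF₀p⟩ : ProbabilityMeasure U) ∈ mixingDensities μ :=
      ⟨_, hf.ennreal_ofReal, rfl⟩
    exact (subset_closure : mixingDensities μ ⊆ mixingClosure μ) this
  have hmix : ∀ (F : Measure U) [IsProbabilityMeasure F], Measurable (mixture k F) := fun F _ =>
    hk.stronglyMeasurable.integral_prod_right.measurable
  have hKLF : ∀ F : ProbabilityMeasure U, F ∈ mixingClosure μ → _ := fun F hF =>
    KL_eq_integral hm hm1 (hmix F) (lintegral_mixture_eq_one hk hk0 hkb hk1 F) (hKL F hF)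
  -- A finite divergence at `F₀` makes its mixture positive `Q`-almost everywhere; the ratio bound
  -- spreads this to the kernel at every point.
  have hpos : ∀ u, ∀ᵐ y ∂Q, 0 < k y u := fun u =>
    ae_pos_of_ratio hk hk0 hratioQ F₀ (hKLF _ hF₀mem).1 u
  -- Positivity holds only almost everywhere, but the recursion needs positive normalizing integrals
  -- along every sequence. Replacing the kernel by 1 on this null set provides them, and almost
  -- surely the data never enter the set, so their recursion is unchanged.
  set N : Set 𝒴 := toMeasurable Q {y | ¬ ∀ᵐ u ∂μ, 0 < k y u} with hN
  have hNm : MeasurableSet N := measurableSet_toMeasurable _ _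
  have hQN : Q N = 0 := by
    rw [hN, measure_toMeasurable]; exact ae_iff.1 (ae_ae_pos hk hpos μ)
  have hNae : ∀ᵐ y ∂Q, y ∉ N := measure_eq_zero_iff_ae_notMem.1 hQN
  have hreg : RegularRecursion μ Q (trivializeOn N k) A w f₀ := by
    refine ⟨regularKernel_trivializeOn hNm hQN hk hk0 hkb hpos hratioQ, fun y => ?_, hw, hf, hf0,
      hf1⟩
    by_cases hy : y ∈ N
    · exact ae_of_all _ fun u => by rw [trivializeOn_of_mem hy]; exact one_pos
    · rw [trivializeOn_of_notMem hy]
      by_contra hcon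
      exact hy (subset_toMeasurable _ _ hcon)
  have hmixae : ∀ F : Measure U, mixture (trivializeOn N k) F =ᵐ[Q] mixture k F := fun F => by
    filter_upwards [hNae] with y hy
    simp only [mixture, trivializeOn_of_notMem hy]
  have hlogae : ∀ F : Measure U,
      (fun y => Real.log (m y) - Real.log (mixture (trivializeOn N k) F y)) =ᵐ[Q]
        fun y => Real.log (m y) - Real.log (mixture k F y) := fun F => by
    filter_upwards [hmixae F] with y hy
    rw [hy]
  have hc : ∀ (F : Measure U) [IsProbabilityMeasure F], Integrable
      (fun y => Real.log (m y) - Real.log (mixture (trivializeOn N k) F y)) Q := fun F _ =>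
    hreg.kernel.integrable_sub_log F₀ ((hKLF _ hF₀mem).2.1.congr (hlogae F₀).symm) F
  have hdiv : ∀ F ∈ mixingClosure μ, divergence Q (fun y => Real.log (m y)) (trivializeOn N k)
      (F : Measure U) = (KL ν m (mixture k (F : Measure U))).toReal := fun F hF => by
    rw [(hKLF F hF).2.2, divergence, integral_congr_ae (hlogae F)]
  have hKle : ∀ F ∈ mixingClosure μ, KStar μ ν m k ≤ KL ν m (mixture k (F : Measure U)) :=
    fun F hF => iInf₂_le F hF
  have hKtop : KStar μ ν m k ≠ ∞ := ne_top_of_le_ne_top (hKL _ hF₀mem) (hKle _ hF₀mem)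
  -- All divergences over the closure are finite, so the extended-valued infimum becomes a real
  -- greatest lower bound.
  have hglb : IsGLB ((fun F : ProbabilityMeasure U => divergence Q (fun y => Real.log (m y))
      (trivializeOn N k) (F : Measure U)) '' mixingClosure μ) (KStar μ ν m k).toReal := by
    constructor
    · rintro _ ⟨F, hF, rfl⟩
      simp only [hdiv F hF]
      exact ENNReal.toReal_mono (hKL F hF) (hKle F hF)
    · intro b hb
      refine (ENNReal.ofReal_le_iff_le_toReal hKtop).1 (le_iInf₂ fun F hF => ?_)
      refine (ENNReal.ofReal_le_iff_le_toReal (hKL F hF)).2 ?_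
      rw [← hdiv F hF]
      exact hb ⟨F, hF, rfl⟩
  refine ⟨hKtop, ?_⟩
  have hYN : ∀ᵐ ω ∂P, ∀ i, Y i ω ∉ N := ae_all_iff.2 fun i => by
    have hi : ∀ᵐ y ∂(P.map (Y i)), y ∉ N := by rw [hlaw i]; exact hNae
    exact ae_of_ae_map (hY i).aemeasurable hi
  have hcont' : ∀ y, Continuous (trivializeOn N k y) := fun y => by
    by_cases hy : y ∈ N
    · have e : trivializeOn N k y = fun _ => 1 := funext (trivializeOn_of_mem hy)
      rw [e]; exact continuous_const
    · rw [trivializeOn_of_notMem hy]; exact hcont y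
  filter_upwards [hYN, hreg.ae_tendsto_average_log hcont' hsupp hwsum hsq hY hind hlaw hm.log hc
    hglb] with ω hω hlim
  have e : ∀ i, prMixture μ (trivializeOn N k) w f₀ (fun j => Y j ω) i (Y i ω) =
      prMixture μ k w f₀ (fun j => Y j ω) i (Y i ω) := fun i => by
    simp only [prMixture, prDensity_trivializeOn hω, trivializeOn_of_notMem (hω i)]
  refine ⟨fun i => ?_, ?_⟩
  · rw [← e, hreg.prMixture_eq]
    exact hreg.mixture_prMeasure_pos _ i _
  · simpa only [e] using hlim

end Consistency

end PRML

/-! ### Comparison of finitely many parameters -/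

theorem theorem3
    {Ω Θ 𝒴 U : Type*}
    [MeasurableSpace Ω] (P : Measure Ω) [IsProbabilityMeasure P]
    -- the parameter set is finite; its topology only serves to speak of convergence
    [Finite Θ] [TopologicalSpace Θ]
    -- the sample space and its dominating measure
    [MeasurableSpace 𝒴] (ν : Measure 𝒴) [SigmaFinite ν]
    -- the mixing space and its dominating measure
    [TopologicalSpace U] [TopologicalSpace.MetrizableSpace U] [SecondCountableTopology U]
    [MeasurableSpace U] [BorelSpace U] (μ : Measure U) [SigmaFinite μ]
    -- the kernels: jointly measurable, and probability densities in the first variable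
    (p : Θ → 𝒴 → U → ℝ)
    (hp_meas : ∀ θ, Measurable fun z : 𝒴 × U => p θ z.1 z.2)
    (hp_nonneg : ∀ θ y u, 0 ≤ p θ y u)
    (hp_dens : ∀ θ u, ∫⁻ y, ENNReal.ofReal (p θ y u) ∂ν = 1)
    -- the initial densities, of full support
    (f₀ : Θ → U → ℝ)
    (hf₀_meas : ∀ θ, Measurable (f₀ θ))
    (hf₀_nonneg : ∀ θ u, 0 ≤ f₀ θ u)
    (hf₀_dens : ∀ θ, ∫⁻ u, ENNReal.ofReal (f₀ θ u) ∂μ = 1)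
    (hf₀_supp : ∀ θ (O : Set U), IsOpen O → μ O ≠ 0 → ∫⁻ u in O, ENNReal.ofReal (f₀ θ u) ∂μ ≠ 0)
    -- the weights
    (w : ℕ → ℝ) (hw : ∀ i, w i ∈ Set.Ioo (0 : ℝ) 1)
    -- Assumption 1: independent observations with common density `m`, finite divergences
    (m : 𝒴 → ℝ) (hm_meas : Measurable m) (hm_nonneg : ∀ y, 0 ≤ m y)
    (Y : ℕ → Ω → 𝒴) (hY_meas : ∀ i, Measurable (Y i)) (hY_indep : iIndepFun Y P)
    (hY_law : ∀ i, P.map (Y i) = ν.withDensity fun y => ENNReal.ofReal (m y))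
    (hKL : ∀ θ, ∀ F ∈ PRML.mixingClosure μ,
      PRML.KL ν m (PRML.mixture (p θ) (F : Measure U)) ≠ ∞)
    -- Assumption 2
    (hw_sum : Tendsto (fun n => ∑ i ∈ Finset.range n, w i) atTop atTop)
    (hw_sq : Summable fun i => w i ^ 2)
    -- Assumption 3
    (hcompact : IsCompact (PRML.mixingClosure μ))
    -- Assumption 4
    (hp_cont : ∀ θ y, Continuous (p θ y))
    (hp_bdd : ∀ θ y, ∃ C : ℝ, ∀ u, p θ y u ≤ C)
    -- Assumption 5
    (hratio : ∀ θ₁ θ₂, ∃ A : ℝ≥0, ∀ u₁ u₂,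
      ∫⁻ y, (ENNReal.ofReal (p θ₁ y u₁) / ENNReal.ofReal (p θ₂ y u₂)) ^ 2
        * ENNReal.ofReal (m y) ∂ν ≤ A)
    -- Assumption 6
    (hlog : ∀ θ, ∃ B : ℝ≥0, ∀ F ∈ PRML.mixingClosure μ,
      PRML.KL ν m (PRML.mixture (p θ) (F : Measure U)) = PRML.KStar μ ν m (p θ) →
      ∫⁻ y, ENNReal.ofReal
        (Real.log (m y / PRML.mixture (p θ) (F : Measure U) y) ^ 2 * m y) ∂ν ≤ B)
    -- the estimator: any maximizer of the marginal likelihood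
    (θhat : ℕ → Ω → Θ)
    (hθhat : ∀ n, ∀ᵐ ω ∂P, ∀ θ,
      PRML.prML μ (p θ) w (f₀ θ) (fun i => Y i ω) n
        ≤ PRML.prML μ (p (θhat n ω)) w (f₀ (θhat n ω)) (fun i => Y i ω) n) :
    (∀ᵐ ω ∂P, ∀ᶠ n in atTop, θhat n ω ∈ PRML.ThetaStar μ ν m p) ∧
    (∀ θstar, PRML.ThetaStar μ ν m p = {θstar} →
      ∀ᵐ ω ∂P, Tendsto (fun n => θhat n ω) atTop (𝓝 θstar)) := by

  obtain ⟨ω₀⟩ : Nonempty Ω := nonempty_of_isProbabilityMeasure P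
  have : Nonempty Θ := ⟨θhat 0 ω₀⟩
  choose A hA using fun θ => hratio θ θ
  have hmain := fun θ => PRML.ae_tendsto_average_log_prMixture (P := P) (μ := μ) (k := p θ)
    (hp_meas θ) (hp_nonneg θ) (hp_dens θ) (hf₀_meas θ) (hf₀_nonneg θ) (hf₀_dens θ) (hf₀_supp θ) hw
    hm_meas hY_meas hY_indep hY_law (hKL θ) hw_sum hw_sq (hp_cont θ) (hp_bdd θ) (hA θ)
  obtain ⟨θ₀, hθ₀⟩ := exists_eq_ciInf_of_finite (f := fun θ => PRML.KStar μ ν m (p θ))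
  have hfirst : ∀ᵐ ω ∂P, ∀ᶠ n in atTop, θhat n ω ∈ PRML.ThetaStar μ ν m p := by
    filter_upwards [ae_all_iff.2 fun θ => (hmain θ).2, ae_all_iff.2 hθhat] with ω hlim hmax
    have hev : ∀ᶠ n in atTop, ∀ θ, θ ∉ PRML.ThetaStar μ ν m p →
        PRML.prML μ (p θ) w (f₀ θ) (fun i => Y i ω) n <
          PRML.prML μ (p θ₀) w (f₀ θ₀) (fun i => Y i ω) n := by
      refine eventually_all.2 fun θ => ?_
      by_cases hθ : θ ∈ PRML.ThetaStar μ ν m p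
      · exact Eventually.of_forall fun n h => absurd hθ h
      have hlt : PRML.KStar μ ν m (p θ₀) < PRML.KStar μ ν m (p θ) := by
        rw [hθ₀]
        exact lt_of_le_of_ne (iInf_le _ θ) fun h => hθ h.symm
      have hlt' := (ENNReal.toReal_lt_toReal (hmain θ₀).1 (hmain θ).1).2 hlt
      -- In the difference of the two averages log m cancels, leaving 1 / n times the log-likelihood
      -- of θ₀ minus that of θ. Its limit is the positive gap between the smallest divergences.
      filter_upwards [((hlim θ).2.sub (hlim θ₀).2).eventually_const_lt (sub_pos.2 hlt'),
        eventually_gt_atTop 0] with n hn hn0 _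
      have hlog : ∀ θ, Real.log (PRML.prML μ (p θ) w (f₀ θ) (fun i => Y i ω) n) =
          ∑ i ∈ Finset.range n,
            Real.log (PRML.prMixture μ (p θ) w (f₀ θ) (fun j => Y j ω) i (Y i ω)) := fun θ =>
        Real.log_prod fun i _ => ((hlim θ).1 i).ne'
      have hpos : ∀ θ, 0 < PRML.prML μ (p θ) w (f₀ θ) (fun i => Y i ω) n := fun θ =>
        Finset.prod_pos fun i _ => (hlim θ).1 i
      rw [← mul_sub, Finset.sum_sub_distrib, Finset.sum_sub_distrib, ← hlog, ← hlog] at hn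
      have h1 := (pos_iff_pos_of_mul_pos hn).1 (inv_pos.2 (Nat.cast_pos.2 hn0))
      exact (Real.log_lt_log_iff (hpos θ) (hpos θ₀)).1 (by linarith)
    filter_upwards [hev] with n hn
    by_contra hcon
    exact absurd (hmax n θ₀) (not_le.2 (hn _ hcon))
  refine ⟨hfirst, fun θstar hθstar => ?_⟩
  filter_upwards [hfirst] with ω hω
  -- The estimator is eventually equal to the unique minimizer, so it converges in any topology on
  -- Θ.
  refine tendsto_const_nhds.congr' ?_
  filter_upwards [hω] with n hn
  rw [hθstar] at hn
  exact (Set.mem_singleton_iff.1 hn).symm
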